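/- **Setting.** There are $k\ge 1$ desired labels $\mathcal Y=\{y_1,\dots,y_k\}$, one of which may be a special label "unknown", and $\hat k$ seen labels $\hat{\mathcal Y}=\{\hat y_1,\dots,\hat y_{\hat k}\}$, disjoint from $\mathcal Y$. Indirect labeling functions $\lambda_1,\dots,\lambda_n$ map a data point $X\in\mathcal X$ to labels in nonempty sets $\mathcal Y_1,\dots,\mathcal Y_n$ with union $\hat{\mathcal Y}$; put $\lambda=(\lambda_1,\dots,\lambda_n)$. A label graph assigns to each ordered pair of labels one of the relations exclusive ($e$), overlapping ($o$), subsuming ($sg$), subsumed ($sd$), with the converse relation for the reversed pair. Let $\mathcal Y'$ be $\mathcal Y$ without "unknown", $k'=|\mathcal Y'|$, and $\mathcal N(y,\mathcal Y_j)=\{\hat y\in\mathcal Y_j:\ y,\hat y \text{ not exclusive}\}$. For $Y\in\mathcal Y$, $\bar Y\in\{0,1\}^{\hat k}$, $\hat Y\in\prod_j\mathcal Y_j$, let $\Phi(Y,\bar Y,\hat Y)\in\mathbb R^M$ be the vector of all the following $M$ factors: $\mathbb 1\{Y=y,\hat Y^j=\hat y\}$ for $y\in\mathcal Y'$, $j\le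 n$, $\hat y\in\mathcal N(y,\mathcal Y_j)$; $\mathbb 1\{\bar Y^i=1,\hat Y^j=\hat y_i\}$ for $\hat y_i\in\mathcal Y_j$; and one relation factor for each pair $(\hat y_i,\hat y_j)$, $i<j$, and each pair $(y,\hat y_i)$ with $y\in\mathcal Y'$, namely $-\mathbb 1\{a=b=1\}$, $\mathbb 1\{a=b=1\}$, $-\mathbb 1\{a=0,b=1\}$, $-\mathbb 1\{a=1,b=0\}$ if the relation is $e$, $o$, $sg$, $sd$ respectively, where $(a,b)=(\bar Y^i,\bar Y^j)$, respectively $(a,b)=(\mathbb 1\{Y=y\},\bar Y^i)$. The model is $\pi_\Theta(Y,\bar Y,\hat Y)\propto\exp(\Theta^\top\Phi(Y,\bar Y,\hat Y))$, $\Theta\in\mathbb R^M$. Let $\mathcal F\subseteq\mathbb R^M$ be a closed convex set of feasible parameters (possibly $\mathcal F=\mathbb R^M$), let $\Theta^*,\Theta_0\in\mathcal F$ and $c>0$. The end model with parameter $w$ has logits $h(X,w)\in\mathbb R^{k}$. Let $\mathcal H(Y,\sigma(h))$ be the cross entropy of $Y$ and the softmax of $h$. For a problem distribution $\pi^*$ of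 $(X,Y)$ put $$\ell(w)=\mathbb E_{\pi^*}\,\mathcal H(Y,\sigma(h(X,w))),\qquad \ell_\Theta(w)=\mathbb E_{X\sim\pi^*}\,\mathbb E_{Y\sim\pi_\Theta(\cdot\mid\hat Y=\lambda(X))}\,\mathcal H(Y,\sigma(h(X,w))),$$ and $\ell(w^*)=\inf_w\ell(w)$. **Algorithm.** Let $D$ be a dataset of $|D|\ge 1$ i.i.d. data points from the $X$-marginal of $\pi^*$. Start at $\hat\Theta=\Theta_0$; for each $X\in D$ in turn sample independently $s\sim\pi_{\hat\Theta}$ and $s'\sim\pi_{\hat\Theta}(\cdot\mid\hat Y=\lambda(X))$, and replace $\hat\Theta$ by the point of $\mathcal F$ nearest to $\hat\Theta+\eta(\Phi(s')-\Phi(s))$. After one pass over $D$ let $\hat w$ be a minimizer of the empirical noise-aware loss $\frac1{|D|}\sum_{X\in D}\mathbb E_{Y\sim\pi_{\hat\Theta}(\cdot\mid\hat Y=\lambda(X))}\mathcal H(Y,\sigma(h(X,w)))$. **Assumptions.** 1. $\mathbb P_{\pi^*}(Y=y,\lambda(X)=o)=\pi_{\Theta^*}(Y=y,\hat Y=o)$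 for all $y,o$. 2. Under $\pi^*$, $Y$ is independent of $X$ given $\lambda(X)$. 3. For each $\Theta\in\mathcal F$ there is an estimator $T$, a function of $|D|$ i.i.d. samples of $\pi_\Theta$, that is unbiased at $\Theta$ to first order (the bias $\Theta'\mapsto\mathbb E_{\Theta'}T-\Theta'$ and its derivative vanish at $\Theta$) and has $\mathrm{Cov}_\Theta(T)\preceq\frac{I}{2c|D|}$. 4. For each $\Theta\in\mathcal F$, $$\mathbb E_{o\sim\pi_{\Theta^*}(\hat Y)}\Big[\sum_{y\in\mathcal Y'}(n_y+\hat k)\mathrm{Var}_{\pi_\Theta}(\mathbb 1_{Y=y}\mid\hat Y=o)^2+\sum_{i=1}^{\hat k}(m_i+\hat k+k'-1)\mathrm{Var}_{\pi_\Theta}(\bar Y^i\mid\hat Y=o)^2\Big]^{1/2}\le\frac{c}{\sqrt{2M}},$$ where $n_y$ is the number of $j$ with $\mathcal N(y,\mathcal Y_j)\ne\emptyset$ and $m_i$ the number of $j$ with $\hat y_i\in\mathcal Y_j$. 5. $\|h(X,w)\|_\infty\le H$ for all $X,w$. 6. $\mathbb E[\ell_{\hat\Theta}(\hat w)-\inf_w\ell_{\hat\Theta}(w)]\le\chi$.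 **Conclusion.** (a) If $\varepsilon>0$, $\eta=\frac{c\varepsilon^2}{4}$ and $|D|>\frac{2}{c^2\varepsilon^2}\log\frac{2\|\Theta_0-\Theta^*\|^2}{\varepsilon^2}$, then $$\mathbb E\|\hat\Theta-\Theta^*\|^2\le M\varepsilon^2,\qquad \mathbb E[\ell(\hat w)-\ell(w^*)]\le\chi+4cH\varepsilon.$$ (b) The rates $O(M\log|D|/|D|)$ and $\chi+O(H\sqrt{\log|D|/|D|})$ are attained: if $|D|\ge2$ and $\eta=\frac{\log|D|}{c|D|}$, then $$\mathbb E\|\hat\Theta-\Theta^*\|^2\le\frac4{c^2}\,M\,\frac{\log|D|}{|D|},\qquad \mathbb E[\ell(\hat w)-\ell(w^*)]\le\chi+8H\sqrt{\frac{\log|D|}{|D|}}.$$ (If $\Theta_0=\Theta^*$ in (a), the condition on $|D|$ is void.) -/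

import Mathlib

open MeasureTheory ProbabilityTheory
open scoped BigOperators ENNReal

noncomputable section

/-- The four types of relation between two labels, each label being thought of as a set. -/
inductive LabelRel where
  | exclusive
  | overlapping
  | subsuming
  | subsumed
  deriving DecidableEq

/-- The relation seen from the other side. -/
def LabelRel.converse : LabelRel → LabelRel
  | .exclusive => .exclusive
  | .overlapping => .overlapping
  | .subsuming => .subsumed
  | .subsumed => .subsuming

/-- A specification of weak indirect supervision: `k` desired labels `Fin k`, `khat` seen labels
`Fin khat` (disjoint from the desired ones), and `n` indirect labeling functions, the `j`-th of
which outputs labels in the nonempty set `space j` of seen labels; the seen labels are exactly the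
labels that some labeling function can output. `rel` is the label graph on all labels.
`unknown` is the desired label (if there is one) that stands for "unknown" and has no factors. -/
structure WIS (k khat n : ℕ) where
  space : Fin n → Finset (Fin khat)
  space_nonempty : ∀ j, (space j).Nonempty
  space_cover : ∀ i, ∃ j, i ∈ space j
  rel : Fin k ⊕ Fin khat → Fin k ⊕ Fin khat → LabelRel
  rel_converse : ∀ a b, a ≠ b → rel b a = (rel a b).converse
  unknown : Option (Fin k)

namespace WIS

variable {k khat n : ℕ} (G : WIS k khat n)

/-- The desired labels other than "unknown". -/
abbrev Known : Type := {y : Fin k // G.unknown ≠ some y}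

/-- Type of the concatenated outputs `Ŷ = (Ŷ¹, …, Ŷⁿ)` of the labeling functions. -/
abbrev Out : Type := (j : Fin n) → {i : Fin khat // i ∈ G.space j}

/-- The joint values `(Y, Ȳ, Ŷ)` of the model. -/
abbrev State : Type := Fin k × (Fin khat → Bool) × G.Out

/-- The set `N(y, 𝒴_j)` of labels of the `j`-th labeling function not exclusive to `y`. -/
def nonExcl (y : Fin k) (j : Fin n) : Finset (Fin khat) :=
  (G.space j).filter fun i => G.rel (Sum.inl y) (Sum.inr i) ≠ LabelRel.exclusive

/-- The factors of the model, in this order: pseudo accuracy `(y, j, ŷ)` with `ŷ ∈ N(y, 𝒴_j)`;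
accuracy `(j, ŷ)` with `ŷ ∈ 𝒴_j`; relation between two seen labels `i < j`; relation between a
desired and a seen label. -/
abbrev Factor : Type :=
  {p : G.Known × Fin n × Fin khat // p.2.2 ∈ G.nonExcl p.1 p.2.1} ⊕
  {p : Fin n × Fin khat // p.2 ∈ G.space p.1} ⊕
  {p : Fin khat × Fin khat // p.1 < p.2} ⊕
  (G.Known × Fin khat)

/-- The parameter space `ℝ^M`. -/
abbrev Param : Type := EuclideanSpace ℝ G.Factor

/-- The number `M` of factors. -/
def numFactors : ℕ := Fintype.card G.Factor

/-- Factor of a label pair with relation `r`, in terms of "the data has the first label" and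
"the data has the second label". -/
def relFactor (r : LabelRel) (a b : Bool) : ℝ :=
  match r with
  | .exclusive => if a = true ∧ b = true then -1 else 0
  | .overlapping => if a = true ∧ b = true then 1 else 0
  | .subsuming => if a = false ∧ b = true then -1 else 0
  | .subsumed => if a = true ∧ b = false then -1 else 0

/-- The factor functions. -/
def factor : G.Factor → G.State → ℝ
  | .inl p, s => if s.1 = p.1.1.1 ∧ (s.2.2 p.1.2.1).1 = p.1.2.2 then 1 else 0
  | .inr (.inl p), s => if s.2.1 p.1.2 = true ∧ (s.2.2 p.1.1).1 = p.1.2 then 1 else 0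
  | .inr (.inr (.inl p)), s =>
      relFactor (G.rel (Sum.inr p.1.1) (Sum.inr p.1.2)) (s.2.1 p.1.1) (s.2.1 p.1.2)
  | .inr (.inr (.inr p)), s =>
      relFactor (G.rel (Sum.inl p.1.1) (Sum.inr p.2)) (decide (s.1 = p.1.1)) (s.2.1 p.2)

/-- The vector `Φ(Y, Ȳ, Ŷ)` of all factors. -/
def feat (s : G.State) : G.Param := WithLp.toLp 2 fun f => G.factor f s

/-- The unnormalized weight `exp (Θᵀ Φ)`. -/
def weight (Θ : G.Param) (s : G.State) : ℝ := Real.exp (∑ f, Θ f * G.factor f s)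

/-- The model `π_Θ(Y, Ȳ, Ŷ) ∝ exp (Θᵀ Φ(Y, Ȳ, Ŷ))`. -/
def prob (Θ : G.Param) (s : G.State) : ℝ := G.weight Θ s / ∑ s', G.weight Θ s'

/-- The conditional law `π_Θ(Y, Ȳ, Ŷ | Ŷ = o)`. -/
def condProb (Θ : G.Param) (o : G.Out) (s : G.State) : ℝ :=
  if s.2.2 = o then G.weight Θ s / ∑ s', (if s'.2.2 = o then G.weight Θ s' else 0) else 0

/-- The marginal law `π_Θ(Ŷ = o)`. -/
def outProb (Θ : G.Param) (o : G.Out) : ℝ := ∑ s, if s.2.2 = o then G.prob Θ s else 0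

/-- The marginal law `π_Θ(Y = y, Ŷ = o)`. -/
def labelOutProb (Θ : G.Param) (y : Fin k) (o : G.Out) : ℝ :=
  ∑ s, if s.1 = y ∧ s.2.2 = o then G.prob Θ s else 0

/-- The probabilistic label `π_Θ(Y = y | Ŷ = o)`. -/
def posterior (Θ : G.Param) (o : G.Out) (y : Fin k) : ℝ :=
  ∑ s, if s.1 = y then G.condProb Θ o s else 0

/-- The conditional variance `Var_{π_Θ}(g | Ŷ = o)`. -/
def condVar (Θ : G.Param) (o : G.Out) (g : G.State → ℝ) : ℝ :=
  ∑ s, G.condProb Θ o s * (g s - ∑ s', G.condProb Θ o s' * g s') ^ 2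

/-! ### Stochastic gradient ascent on the marginal log-likelihood -/

theorem weight_pos (Θ : G.Param) (s : G.State) : 0 < G.weight Θ s := Real.exp_pos _

instance [NeZero k] : Nonempty G.State :=
  ⟨(0, fun _ => true, fun j => ⟨(G.space_nonempty j).choose, (G.space_nonempty j).choose_spec⟩)⟩

theorem sum_weight_pos [NeZero k] (Θ : G.Param) : 0 < ∑ s, G.weight Θ s :=
  Finset.sum_pos (fun s _ => G.weight_pos Θ s) Finset.univ_nonempty

theorem sum_weight_out_pos [NeZero k] (Θ : G.Param) (o : G.Out) :
    0 < ∑ s : G.State, (if s.2.2 = o then G.weight Θ s else 0) := by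
  refine Finset.sum_pos' (fun s _ => ?_) ⟨((0 : Fin k), fun _ => true, o), Finset.mem_univ _, ?_⟩
  · split_ifs
    · exact (G.weight_pos Θ s).le
    · exact le_rfl
  · simpa using G.weight_pos Θ _

theorem prob_nonneg [NeZero k] (Θ : G.Param) (s : G.State) : 0 ≤ G.prob Θ s :=
  div_nonneg (G.weight_pos Θ s).le (G.sum_weight_pos Θ).le

theorem sum_prob [NeZero k] (Θ : G.Param) : ∑ s, G.prob Θ s = 1 := by
  simp only [prob]
  rw [← Finset.sum_div, div_self (G.sum_weight_pos Θ).ne']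

theorem condProb_nonneg [NeZero k] (Θ : G.Param) (o : G.Out) (s : G.State) :
    0 ≤ G.condProb Θ o s := by
  unfold condProb
  split_ifs
  · exact div_nonneg (G.weight_pos Θ s).le (G.sum_weight_out_pos Θ o).le
  · exact le_rfl

theorem sum_condProb [NeZero k] (Θ : G.Param) (o : G.Out) : ∑ s, G.condProb Θ o s = 1 := by
  have h : ∀ s : G.State, G.condProb Θ o s = (if s.2.2 = o then G.weight Θ s else 0) /
      ∑ s' : G.State, (if s'.2.2 = o then G.weight Θ s' else 0) := by
    intro s
    unfold condProb
    split_ifs <;> simp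
  simp only [h]
  rw [← Finset.sum_div, div_self (G.sum_weight_out_pos Θ o).ne']

/-- `π_Θ` as a law to sample from. -/
def probPMF [NeZero k] (Θ : G.Param) : PMF G.State :=
  PMF.ofFintype (fun s => ENNReal.ofReal (G.prob Θ s)) (by
    rw [← ENNReal.ofReal_sum_of_nonneg fun s _ => G.prob_nonneg Θ s, G.sum_prob,
      ENNReal.ofReal_one])

/-- `π_Θ(· | Ŷ = o)` as a law to sample from. -/
def condPMF [NeZero k] (Θ : G.Param) (o : G.Out) : PMF G.State :=
  PMF.ofFintype (fun s => ENNReal.ofReal (G.condProb Θ o s)) (by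
    rw [← ENNReal.ofReal_sum_of_nonneg fun s _ => G.condProb_nonneg Θ o s, G.sum_condProb,
      ENNReal.ofReal_one])

open Classical in
/-- A nearest point of `F` to `Θ` (unique if `F` is nonempty, closed and convex; `Θ` itself if
`F` is the whole space). -/
def proj (F : Set G.Param) (Θ : G.Param) : G.Param :=
  if h : ∃ v ∈ F, ∀ u ∈ F, ‖Θ - v‖ ≤ ‖Θ - u‖ then h.choose else Θ

/-- One step of stochastic gradient ascent at a data point with labeling-function output `o`:
sample `s ∼ π_Θ` and, independently, `s' ∼ π_Θ(· | Ŷ = o)`, and move `Θ` to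
`Θ + η (Φ(s') - Φ(s))`, projected to the feasible set `F`. -/
def sgdStep [NeZero k] (F : Set G.Param) (η : ℝ) (o : G.Out) (Θ : G.Param) : PMF G.Param :=
  (G.probPMF Θ).bind fun s => (G.condPMF Θ o).bind fun s' =>
    PMF.pure (G.proj F (Θ + η • (G.feat s' - G.feat s)))

/-- The law of the parameter after one pass over the data, starting from `Θ`. -/
def sgd [NeZero k] (F : Set G.Param) (η : ℝ) : List G.Out → G.Param → PMF G.Param
  | [], Θ => PMF.pure Θ
  | o :: L, Θ => (G.sgdStep F η o Θ).bind fun Θ' => sgd F η L Θ'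

/-! ### The end model and its risks -/

/-- Cross entropy of the label `y` and the softmax of the logits `v`. -/
def crossEntropy (v : Fin k → ℝ) (y : Fin k) : ℝ :=
  -Real.log (Real.exp (v y) / ∑ l, Real.exp (v l))

variable {X W Ω : Type*}

/-- The labeling functions, applied together. -/
def outputs (lam : (j : Fin n) → X → {i : Fin khat // i ∈ G.space j}) (x : X) : G.Out :=
  fun j => lam j x

/-- The noise-aware loss at a point: the expectation of the cross entropy under the probabilistic
label. -/
def noisyLoss (lam : (j : Fin n) → X → {i : Fin khat // i ∈ G.space j})
    (h : W → X → Fin k → ℝ) (Θ : G.Param) (w : W) (x : X) : ℝ :=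
  ∑ y, G.posterior Θ (G.outputs lam x) y * crossEntropy (h w x) y

/-- The empirical noise-aware loss over a dataset. -/
def empiricalLoss (lam : (j : Fin n) → X → {i : Fin khat // i ∈ G.space j})
    (h : W → X → Fin k → ℝ) {m : ℕ} (x : Fin m → X) (Θ : G.Param) (w : W) : ℝ :=
  (1 / (m : ℝ)) * ∑ t, G.noisyLoss lam h Θ w (x t)

/-- The expected risk `ℓ(w)` of the end model under the problem distribution. -/
def risk [MeasurableSpace X] (π : Measure (X × Fin k)) (h : W → X → Fin k → ℝ) (w : W) : ℝ :=
  ∫ p, crossEntropy (h w p.1) p.2 ∂π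

/-- The expected noise-aware risk `ℓ_Θ(w)`. -/
def noisyRisk [MeasurableSpace X] (π : Measure (X × Fin k))
    (lam : (j : Fin n) → X → {i : Fin khat // i ∈ G.space j})
    (h : W → X → Fin k → ℝ) (Θ : G.Param) (w : W) : ℝ :=
  ∫ p, G.noisyLoss lam h Θ w p.1 ∂π

/-! ### The assumptions -/

/-- The problem distribution agrees with `π_Θ` on `(Y, Ŷ)`. -/
def WellSpecified [MeasurableSpace X] (π : Measure (X × Fin k))
    (lam : (j : Fin n) → X → {i : Fin khat // i ∈ G.space j}) (Θ : G.Param) : Prop :=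
  ∀ y o, π.real {p | p.2 = y ∧ G.outputs lam p.1 = o} = G.labelOutProb Θ y o

/-- `Y` is independent of `X` given the (finitely valued) outputs of the labeling functions. -/
def LabelCondIndep [MeasurableSpace X] (π : Measure (X × Fin k))
    (lam : (j : Fin n) → X → {i : Fin khat // i ∈ G.space j}) : Prop :=
  ∀ o, IndepFun Prod.snd Prod.fst (ProbabilityTheory.cond π {p | G.outputs lam p.1 = o})

/-- The probability of a dataset of `m` independent samples of `π_Θ`. -/
def sampleProb {m : ℕ} (Θ : G.Param) (d : Fin m → G.State) : ℝ := ∏ t, G.prob Θ (d t)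

/-- The expectation of an estimator under `m` independent samples of `π_Θ`. -/
def estMean {m : ℕ} (T : (Fin m → G.State) → G.Param) (Θ : G.Param) : G.Param :=
  ∑ d, G.sampleProb Θ d • T d

/-- `T` is unbiased at `Θ` to first order: its bias vanishes at `Θ` together with its derivative.
Every estimator that is unbiased in a neighbourhood of `Θ` has this property. -/
def UnbiasedAt {m : ℕ} (T : (Fin m → G.State) → G.Param) (Θ : G.Param) : Prop :=
  G.estMean T Θ = Θ ∧ HasFDerivAt (G.estMean T) (ContinuousLinearMap.id ℝ G.Param) Θ

/-- The covariance matrix of `T` under `π_Θ` is at most `b` times the identity. -/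
def CovLE {m : ℕ} (T : (Fin m → G.State) → G.Param) (Θ : G.Param) (b : ℝ) : Prop :=
  ∀ u : G.Param,
    ∑ d, G.sampleProb Θ d * (inner ℝ u (T d - G.estMean T Θ)) ^ 2 ≤ b * ‖u‖ ^ 2

/-- At each feasible parameter there is an unbiased estimator from `m` samples of the full model
with covariance at most `I / (2 c m)`. -/
def EfficientEstimator (F : Set G.Param) (c : ℝ) (m : ℕ) : Prop :=
  ∀ Θ ∈ F, ∃ T : (Fin m → G.State) → G.Param, G.UnbiasedAt T Θ ∧ G.CovLE T Θ (1 / (2 * c * m))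

/-- The number of labeling functions with some label that is not exclusive to `y`. -/
def numNonExcl (y : Fin k) : ℕ := (Finset.univ.filter fun j => (G.nonExcl y j).Nonempty).card

/-- The number of labeling functions whose label space contains the seen label `i`. -/
def numCover (i : Fin khat) : ℕ := (Finset.univ.filter fun j => i ∈ G.space j).card

/-- The weighted sum of squared posterior variances of the latent variables given `Ŷ = o`. -/
def posteriorSpread (Θ : G.Param) (o : G.Out) : ℝ :=
  (∑ y : G.Known, ((G.numNonExcl y : ℝ) + khat) *
      G.condVar Θ o (fun s => if s.1 = y.1 then 1 else 0) ^ 2) +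
    ∑ i : Fin khat, ((G.numCover i : ℝ) + ((khat : ℝ) + Fintype.card G.Known) - 1) *
      G.condVar Θ o (fun s => if s.2.1 i = true then 1 else 0) ^ 2

/-- The latent variables are guessed with reasonable certainty at every feasible parameter. -/
def LowPosteriorVariance (F : Set G.Param) (Θstar : G.Param) (c : ℝ) : Prop :=
  ∀ Θ ∈ F, ∑ o, G.outProb Θstar o * Real.sqrt (G.posteriorSpread Θ o) ≤
    c / Real.sqrt (2 * G.numFactors)

/-- `(D, Θhat, what)` is a run of the learning algorithm: `D` is a dataset of `m` independent data
points; given `D`, the parameter `Θhat` has the law of one pass of stochastic gradient ascent over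
`D` started at `Θ₀`; and `what` minimizes the empirical noise-aware loss with parameter `Θhat`. -/
structure IsRun [NeZero k] [MeasurableSpace X] [MeasurableSpace W] [MeasurableSpace Ω]
    (π : Measure (X × Fin k)) (lam : (j : Fin n) → X → {i : Fin khat // i ∈ G.space j})
    (h : W → X → Fin k → ℝ) (F : Set G.Param) (Θ₀ : G.Param) (η : ℝ) {m : ℕ}
    (P : Measure Ω) (D : Ω → Fin m → X) (Θhat : Ω → G.Param) (what : Ω → W) : Prop where
  measurable_D : Measurable D
  measurable_Θhat : Measurable Θhat
  measurable_what : Measurable what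
  law : ∀ (A : Set (Fin m → X)) (B : Set G.Param), MeasurableSet A → MeasurableSet B →
    P (D ⁻¹' A ∩ Θhat ⁻¹' B) =
      ∫⁻ x in A, (G.sgd F η (List.ofFn fun t => G.outputs lam (x t)) Θ₀).toMeasure B
        ∂(Measure.pi fun _ => π.map Prod.fst)
  argmin : ∀ᵐ ω ∂P, ∀ w,
    G.empiricalLoss lam h (D ω) (Θhat ω) (what ω) ≤ G.empiricalLoss lam h (D ω) (Θhat ω) w

end WIS

end

/-!
Cramér–Rao for the efficient, first-order unbiased estimators gives the lower bound
`Var_Θ (uᵀΦ) ≥ 2c‖u‖²`, while low posterior variance bounds the averaged posterior variance of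
`uᵀΦ` by `c‖u‖²`. The difference of the two is minus the second derivative of the expected marginal
log-likelihood along `u`, so on `F` its gradient has drift `≤ -c‖Θ - Θ*‖²` towards `Θ*`, and the
squared distance of the projected stochastic gradient iterates to `Θ*` contracts geometrically up to
a noise of order `ηM/c`. Since the increments of the factors are bounded, the same drift bounds the
squared diameter of `F` around `Θ*` by `M/c²`, which covers the steps too large to contract.

Every factor is an indicator up to sign, so covariances with a label indicator are controlled by
variances and the posterior is Lipschitz in `Θ` on average. Only the logit part of the cross entropy
depends on the weighting of the labels, so this transfers the parameter error to the risk.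
-/

noncomputable section

/-! ### Finite weighted means, covariances and exponential tilting -/

section FiniteMean

variable {S : Type*} [Fintype S]

/-- The mean of `f` under the weights `p`, written as a sum. -/
def wmean (p f : S → ℝ) : ℝ := ∑ s, p s * f s

/-- The covariance of `f` and `g` under the weights `p`. The symmetrized form, as a mean over pairs,
makes comparisons of covariances pointwise in the increments. -/
def wcov (p f g : S → ℝ) : ℝ :=
  1 / 2 * wmean (fun q : S × S => p q.1 * p q.2) fun q => (f q.1 - f q.2) * (g q.1 - g q.2)

/-- The variance of `f` under the weights `p`. -/
def wvar (p f : S → ℝ) : ℝ := wcov p f f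

/-- The weights `w` normalized to total mass one. -/
def gibbs (w : S → ℝ) (s : S) : ℝ := w s / ∑ s', w s'

theorem wmean_add (p f g : S → ℝ) : wmean p (fun s => f s + g s) = wmean p f + wmean p g := by
  simp only [wmean, mul_add, Finset.sum_add_distrib]

theorem wmean_sub (p f g : S → ℝ) : wmean p (fun s => f s - g s) = wmean p f - wmean p g := by
  simp only [wmean, mul_sub, Finset.sum_sub_distrib]

theorem wmean_const_mul (p : S → ℝ) (a : ℝ) (f : S → ℝ) :
    wmean p (fun s => a * f s) = a * wmean p f := by
  simp only [wmean, Finset.mul_sum, mul_left_comm]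

theorem wmean_sum {ι : Type*} (p : S → ℝ) (I : Finset ι) (f : ι → S → ℝ) :
    wmean p (fun s => ∑ i ∈ I, f i s) = ∑ i ∈ I, wmean p (f i) := by
  simp only [wmean, Finset.mul_sum]
  exact Finset.sum_comm

theorem wmean_const {p : S → ℝ} (hp : ∑ s, p s = 1) (a : ℝ) : wmean p (fun _ => a) = a := by
  rw [wmean, ← Finset.sum_mul, hp, one_mul]

theorem wmean_mono {p f g : S → ℝ} (hp : ∀ s, 0 ≤ p s) (hfg : ∀ s, p s ≠ 0 → f s ≤ g s) :
    wmean p f ≤ wmean p g := by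
  refine Finset.sum_le_sum fun s _ => ?_
  by_cases h : p s = 0
  · simp [h]
  · exact mul_le_mul_of_nonneg_left (hfg s h) (hp s)

theorem wmean_affine {p : S → ℝ} (hp : ∑ s, p s = 1) (a b : ℝ) (f : S → ℝ) :
    wmean p (fun s => a * f s + b) = a * wmean p f + b := by
  rw [wmean_add, wmean_const_mul, wmean_const hp]

theorem wmean_le {p f : S → ℝ} {b : ℝ} (hp : ∀ s, 0 ≤ p s) (hp1 : ∑ s, p s = 1)
    (hf : ∀ s, f s ≤ b) : wmean p f ≤ b :=
  (wmean_mono hp fun s _ => hf s).trans_eq (wmean_const hp1 b)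

theorem le_wmean {p f : S → ℝ} {b : ℝ} (hp : ∀ s, 0 ≤ p s) (hp1 : ∑ s, p s = 1)
    (hf : ∀ s, b ≤ f s) : b ≤ wmean p f :=
  (wmean_const hp1 b).symm.trans_le (wmean_mono hp fun s _ => hf s)

theorem wmean_nonneg {p f : S → ℝ} (hp : ∀ s, 0 ≤ p s) (hf : ∀ s, 0 ≤ f s) : 0 ≤ wmean p f :=
  Finset.sum_nonneg fun s _ => mul_nonneg (hp s) (hf s)

theorem abs_wmean_le {p : S → ℝ} (hp : ∀ s, 0 ≤ p s) (f : S → ℝ) :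
    |wmean p f| ≤ wmean p fun s => |f s| :=
  (Finset.abs_sum_le_sum_abs _ _).trans_eq <|
    Finset.sum_congr rfl fun s _ => by rw [abs_mul, abs_of_nonneg (hp s)]

theorem wcov_eq {p : S → ℝ} (hp : ∑ s, p s = 1) (f g : S → ℝ) :
    wcov p f g = wmean p (fun s => f s * g s) - wmean p f * wmean p g := by
  have hinner (s : S) : ∑ s', p s * p s' * ((f s - f s') * (g s - g s')) =
      p s * (f s * g s) - p s * f s * wmean p g - p s * g s * wmean p f +
        p s * wmean p fun s' => f s' * g s' := by
    rw [← mul_one (p s * (f s * g s)), ← hp]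
    simp only [wmean, Finset.mul_sum, ← Finset.sum_sub_distrib, ← Finset.sum_add_distrib]
    exact Finset.sum_congr rfl fun s' _ => by ring
  rw [wcov, wmean, Fintype.sum_prod_type]
  simp only [hinner, Finset.sum_add_distrib, Finset.sum_sub_distrib, ← Finset.sum_mul, hp]
  simp only [wmean]
  ring

theorem wvar_eq_wmean_sq {p : S → ℝ} (hp : ∑ s, p s = 1) (f : S → ℝ) :
    wvar p f = wmean p fun s => (f s - wmean p f) ^ 2 := by
  have hexpand : (fun s => (f s - wmean p f) ^ 2) =
      fun s => f s * f s - 2 * wmean p f * f s + wmean p f ^ 2 := by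
    funext s
    ring
  rw [wvar, wcov_eq hp, hexpand, wmean_add, wmean_sub, wmean_const_mul, wmean_const hp]
  ring

theorem wvar_nonneg {p : S → ℝ} (hp : ∀ s, 0 ≤ p s) (f : S → ℝ) : 0 ≤ wvar p f :=
  mul_nonneg (by norm_num) <|
    wmean_nonneg (fun q => mul_nonneg (hp q.1) (hp q.2)) fun _ => mul_self_nonneg _

theorem wvar_const (p : S → ℝ) (a : ℝ) : wvar p (fun _ => a) = 0 := by
  simp [wvar, wcov, wmean]

theorem wcov_sum_right {ι : Type*} [Fintype ι] (p f : S → ℝ) (v : ι → ℝ) (g : ι → S → ℝ) :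
    wcov p f (fun s => ∑ i, v i * g i s) = ∑ i, v i * wcov p f (g i) := by
  have hexpand (q : S × S) :
      (f q.1 - f q.2) * (∑ i, v i * g i q.1 - ∑ i, v i * g i q.2) =
        ∑ i, v i * ((f q.1 - f q.2) * (g i q.1 - g i q.2)) := by
    rw [← Finset.sum_sub_distrib, Finset.mul_sum]
    exact Finset.sum_congr rfl fun i _ => by ring
  simp only [wcov, hexpand, wmean_sum, wmean_const_mul, Finset.mul_sum]
  exact Finset.sum_congr rfl fun i _ => mul_left_comm _ _ _

theorem wvar_le_add {p f g h : S → ℝ} (hp : ∀ s, 0 ≤ p s)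
    (hfgh : ∀ s s', p s ≠ 0 → p s' ≠ 0 →
      (f s - f s') ^ 2 ≤ (g s - g s') ^ 2 + (h s - h s') ^ 2) :
    wvar p f ≤ wvar p g + wvar p h := by
  simp only [wvar, wcov, ← mul_add, ← wmean_add, ← sq]
  refine mul_le_mul_of_nonneg_left (wmean_mono (fun q => mul_nonneg (hp _) (hp _)) fun q hq => ?_)
    (by norm_num)
  exact hfgh _ _ (left_ne_zero_of_mul hq) (right_ne_zero_of_mul hq)

theorem wvar_mono {p f g : S → ℝ} (hp : ∀ s, 0 ≤ p s)
    (hfg : ∀ s s', p s ≠ 0 → p s' ≠ 0 → (f s - f s') ^ 2 ≤ (g s - g s') ^ 2) :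
    wvar p f ≤ wvar p g := by
  simpa [wvar_const] using wvar_le_add (h := fun _ => 0) hp fun s s' hs hs' => by
    simpa using hfg s s' hs hs'

theorem abs_wcov_le_two_mul_wvar {p a f : S → ℝ} (hp : ∀ s, 0 ≤ p s) (ha : ∀ s, |a s| ≤ 1)
    (hf : ∀ s s', |f s - f s'| ≤ (f s - f s') ^ 2) :
    |wcov p a f| ≤ 2 * wvar p f := by
  have hpp (q : S × S) : 0 ≤ p q.1 * p q.2 := mul_nonneg (hp _) (hp _)
  rw [wvar, wcov, wcov, abs_mul, abs_of_pos one_half_pos, mul_left_comm, ← wmean_const_mul]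
  refine mul_le_mul_of_nonneg_left ((abs_wmean_le hpp _).trans (wmean_mono hpp fun q _ => ?_))
    (by norm_num)
  have hinc : |a q.1 - a q.2| ≤ 2 := (abs_sub _ _).trans (by linarith [ha q.1, ha q.2])
  rw [abs_mul, ← sq]
  exact mul_le_mul hinc (hf _ _) (abs_nonneg _) (by norm_num)

theorem wcov_sq_le {p : S → ℝ} (hp : ∀ s, 0 ≤ p s) (f g : S → ℝ) :
    wcov p f g ^ 2 ≤ wvar p f * wvar p g := by
  have hpp (q : S × S) : 0 ≤ p q.1 * p q.2 := mul_nonneg (hp _) (hp _)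
  have hcs : wmean (fun q : S × S => p q.1 * p q.2)
        (fun q => (f q.1 - f q.2) * (g q.1 - g q.2)) ^ 2 ≤
      wmean (fun q : S × S => p q.1 * p q.2) (fun q => (f q.1 - f q.2) * (f q.1 - f q.2)) *
        wmean (fun q : S × S => p q.1 * p q.2) (fun q => (g q.1 - g q.2) * (g q.1 - g q.2)) :=
    Finset.sum_sq_le_sum_mul_sum_of_sq_le_mul _ (fun q _ => mul_nonneg (hpp q) (mul_self_nonneg _))
      (fun q _ => mul_nonneg (hpp q) (mul_self_nonneg _)) fun q _ => (by ring : _ = _).le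
  simp only [wvar, wcov, mul_pow]
  linarith

theorem wvar_sum_le {ι : Type*} [Fintype ι] {p : S → ℝ} (hp : ∀ s, 0 ≤ p s) (v : ι → ℝ)
    (g : ι → S → ℝ) :
    wvar p (fun s => ∑ i, v i * g i s) ≤ (∑ i, v i ^ 2) * ∑ i, wvar p (g i) := by
  simp only [wvar, wcov, ← Finset.mul_sum, ← wmean_sum]
  rw [mul_left_comm, ← wmean_const_mul _ (∑ i, v i ^ 2)]
  refine mul_le_mul_of_nonneg_left (wmean_mono (fun q => mul_nonneg (hp _) (hp _)) fun q _ => ?_)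
    one_half_pos.le
  simp only [← sq, ← Finset.sum_sub_distrib, ← mul_sub]
  exact Finset.sum_mul_sq_le_sq_mul_sq _ _ _

theorem sum_gibbs {w : S → ℝ} (hw : ∑ s, w s ≠ 0) : ∑ s, gibbs w s = 1 := by
  simp only [gibbs]
  rw [← Finset.sum_div, div_self hw]

theorem wmean_gibbs (w f : S → ℝ) : wmean (gibbs w) f = (∑ s, w s * f s) / ∑ s, w s := by
  simp only [wmean, gibbs, Finset.sum_div, div_mul_eq_mul_div]

theorem hasDerivAt_wmean_gibbs (w f g : S → ℝ) (t : ℝ)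
    (hZ : ∑ s, w s * Real.exp (t * g s) ≠ 0) :
    HasDerivAt (fun τ : ℝ => wmean (gibbs fun s => w s * Real.exp (τ * g s)) f)
      (wcov (gibbs fun s => w s * Real.exp (t * g s)) f g) t := by
  have hweight (s : S) : HasDerivAt (fun τ : ℝ => w s * Real.exp (τ * g s))
      (w s * Real.exp (t * g s) * g s) t := by
    simpa [mul_assoc] using (((hasDerivAt_id t).mul_const (g s)).exp).const_mul (w s)
  have hnum : HasDerivAt (fun τ : ℝ => ∑ s, w s * Real.exp (τ * g s) * f s)
      (∑ s, w s * Real.exp (t * g s) * (f s * g s)) t :=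
    HasDerivAt.fun_sum fun s _ => ((hweight s).mul_const (f s)).congr_deriv (by ring)
  have hden : HasDerivAt (fun τ : ℝ => ∑ s, w s * Real.exp (τ * g s))
      (∑ s, w s * Real.exp (t * g s) * g s) t := HasDerivAt.fun_sum fun s _ => hweight s
  simp only [wcov_eq (sum_gibbs hZ), wmean_gibbs]
  refine (hnum.fun_div hden hZ).congr_deriv ?_
  field_simp

theorem cramer_rao_gibbs {w g T : S → ℝ} {t d : ℝ} (hw : ∀ s, 0 ≤ w s)
    (hZ : ∑ s, w s * Real.exp (t * g s) ≠ 0)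
    (hT : HasDerivAt (fun τ : ℝ => wmean (gibbs fun s => w s * Real.exp (τ * g s)) T) d t) :
    d ^ 2 ≤ wvar (gibbs fun s => w s * Real.exp (t * g s)) T *
      wvar (gibbs fun s => w s * Real.exp (t * g s)) g := by
  rw [hT.unique (hasDerivAt_wmean_gibbs w T g t hZ)]
  have hweight (s : S) : 0 ≤ w s * Real.exp (t * g s) := mul_nonneg (hw s) (Real.exp_pos _).le
  exact wcov_sq_le (fun s => div_nonneg (hweight s) (Finset.sum_nonneg fun s' _ => hweight s')) T g

theorem wmean_comm {ι : Type*} [Fintype ι] (p : S → ℝ) (q : ι → ℝ) (f : S → ι → ℝ) :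
    wmean p (fun s => wmean q (f s)) = wmean q fun i => wmean p fun s => f s i := by
  simp only [wmean, Finset.mul_sum, mul_left_comm (p _)]
  exact Finset.sum_comm

theorem wmean_pi_eval {ι : Type*} [Fintype ι] [DecidableEq ι] {p : S → ℝ}
    (hp : ∑ s, p s = 1) (g : S → ℝ) (r : ι) :
    wmean (fun d : ι → S => ∏ t, p (d t)) (fun d => g (d r)) = wmean p g := by
  have hfactor (d : ι → S) :
      (∏ t, p (d t)) * g (d r) = ∏ t, p (d t) * if t = r then g (d t) else 1 := by
    rw [Finset.prod_mul_distrib, Fintype.prod_ite_eq' r fun t => g (d t)]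
  have hmarginal (t : ι) : ∑ s, p s * (if t = r then g s else 1) =
      if t = r then wmean p g else 1 := by
    split_ifs
    · rfl
    · simpa using hp
  simp only [wmean, hfactor]
  rw [← Fintype.prod_sum fun t s => p s * if t = r then g s else 1]
  simp only [hmarginal, Fintype.prod_ite_eq']
  rfl

end FiniteMean

theorem sub_le_of_hasDerivAt_le {φ φ' : ℝ → ℝ} {K : ℝ} (hφ : ∀ t, HasDerivAt φ (φ' t) t)
    (hK : ∀ t ∈ Set.Icc (0 : ℝ) 1, φ' t ≤ K) : φ 1 - φ 0 ≤ K := by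
  obtain ⟨t, ht, hslope⟩ := exists_hasDerivAt_eq_slope φ φ' zero_lt_one
    (fun x _ => (hφ x).continuousAt.continuousWithinAt) fun x _ => hφ x
  rw [sub_zero, div_one] at hslope
  exact hslope ▸ hK t ⟨ht.1.le, ht.2.le⟩

theorem sum_subtype_eq_sum_ite {ι : Type*} [Fintype ι] (p : ι → Prop) [DecidablePred p]
    (f : ι → ℝ) : ∑ q : {q // p q}, f q.1 = ∑ q, if p q then f q else 0 := by
  rw [← Finset.sum_filter]
  exact (Finset.sum_subtype _ (by simp) f).symm

theorem sum_lt_pairs_add {ι : Type*} [Fintype ι] [LinearOrder ι] (a : ι → ℝ) :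
    ∑ p : {p : ι × ι // p.1 < p.2}, (a p.1.1 + a p.1.2) =
      ((Fintype.card ι : ℝ) - 1) * ∑ i, a i := by
  have hswap : ∑ i, ∑ j, (if i < j then a j else 0) = ∑ i, ∑ j, if j < i then a i else 0 :=
    Finset.sum_comm
  have htrichotomy (i j : ι) : (if i < j then a i else 0) + (if j < i then a i else 0) =
      a i - if i = j then a i else 0 := by
    rcases lt_trichotomy i j with hij | rfl | hij
    · simp [hij, hij.not_gt, hij.ne]
    · simp
    · simp [hij, hij.not_gt, hij.ne']
  calc ∑ p : {p : ι × ι // p.1 < p.2}, (a p.1.1 + a p.1.2)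
      = ∑ i, ∑ j, if i < j then a i + a j else 0 := by
        rw [sum_subtype_eq_sum_ite (fun p : ι × ι => p.1 < p.2) fun p => a p.1 + a p.2,
          Fintype.sum_prod_type]
    _ = ∑ i, ∑ j, ((if i < j then a i else 0) + if j < i then a i else 0) := by
        simp only [Finset.sum_add_distrib, ← hswap]
        simp only [← Finset.sum_add_distrib, ite_add_ite, add_zero]
    _ = ((Fintype.card ι : ℝ) - 1) * ∑ i, a i := by
        simp [htrichotomy, Finset.mul_sum, sub_mul]

namespace WIS

variable {k khat n : ℕ} (G : WIS k khat n)

/-! ### The model as an exponential family -/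

/-- The weights of the states with outputs `o`; normalized, they are the conditional law. -/
def outWeight (Θ : G.Param) (o : G.Out) (s : G.State) : ℝ := if s.2.2 = o then G.weight Θ s else 0

/-- The linear statistic `uᵀ Φ`, whose mean is the derivative of the log-partition function in the
direction `u`. -/
def linFeat (u : G.Param) (s : G.State) : ℝ := ∑ f, u f * G.factor f s

theorem inner_feat (u : G.Param) (s : G.State) : inner ℝ u (G.feat s) = G.linFeat u s := by
  simp [PiLp.inner_apply, feat, linFeat, mul_comm]

theorem prob_eq_gibbs (Θ : G.Param) : G.prob Θ = gibbs (G.weight Θ) := rfl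

theorem condProb_eq_gibbs (Θ : G.Param) (o : G.Out) : G.condProb Θ o = gibbs (G.outWeight Θ o) := by
  funext s
  simp only [condProb, gibbs, outWeight]
  split_ifs <;> simp

theorem sum_outWeight_pos [NeZero k] (Θ : G.Param) (o : G.Out) : 0 < ∑ s, G.outWeight Θ o s :=
  G.sum_weight_out_pos Θ o

theorem out_eq_of_condProb_ne_zero {Θ : G.Param} {o : G.Out} {s : G.State}
    (hs : G.condProb Θ o s ≠ 0) : s.2.2 = o := by
  by_contra hne
  exact hs (if_neg hne)

theorem weight_add_smul (Θ v : G.Param) (t : ℝ) (s : G.State) :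
    G.weight (Θ + t • v) s = G.weight Θ s * Real.exp (t * G.linFeat v s) := by
  rw [weight, weight, ← Real.exp_add, linFeat, Finset.mul_sum, ← Finset.sum_add_distrib]
  congr 1
  refine Finset.sum_congr rfl fun f _ => ?_
  simp only [PiLp.add_apply, PiLp.smul_apply, smul_eq_mul]
  ring

theorem outWeight_add_smul (Θ v : G.Param) (t : ℝ) (o : G.Out) (s : G.State) :
    G.outWeight (Θ + t • v) o s = G.outWeight Θ o s * Real.exp (t * G.linFeat v s) := by
  simp only [outWeight, weight_add_smul, ite_mul, zero_mul]

theorem hasDerivAt_wmean_prob [NeZero k] (Θ v : G.Param) (f : G.State → ℝ) (t : ℝ) :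
    HasDerivAt (fun τ : ℝ => wmean (G.prob (Θ + τ • v)) f)
      (wcov (G.prob (Θ + t • v)) f (G.linFeat v)) t := by
  have h := hasDerivAt_wmean_gibbs (G.weight Θ) f (G.linFeat v) t (by
    simpa only [← weight_add_smul] using (G.sum_weight_pos _).ne')
  simpa only [← weight_add_smul, ← prob_eq_gibbs] using h

theorem hasDerivAt_wmean_condProb [NeZero k] (Θ v : G.Param) (o : G.Out) (f : G.State → ℝ)
    (t : ℝ) :
    HasDerivAt (fun τ : ℝ => wmean (G.condProb (Θ + τ • v) o) f)
      (wcov (G.condProb (Θ + t • v) o) f (G.linFeat v)) t := by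
  have h := hasDerivAt_wmean_gibbs (G.outWeight Θ o) f (G.linFeat v) t (by
    simpa only [← outWeight_add_smul] using (G.sum_outWeight_pos _ o).ne')
  simpa only [← outWeight_add_smul, ← condProb_eq_gibbs] using h

/-! ### Independent samples and the information inequality -/

theorem sum_sampleProb [NeZero k] {m : ℕ} (Θ : G.Param) :
    ∑ d : Fin m → G.State, G.sampleProb Θ d = 1 := by
  simp only [sampleProb]
  rw [← Fintype.sum_pow, G.sum_prob, one_pow]

theorem prod_weight_add_smul {m : ℕ} (Θ v : G.Param) (t : ℝ) (d : Fin m → G.State) :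
    ∏ r, G.weight (Θ + t • v) (d r) =
      (∏ r, G.weight Θ (d r)) * Real.exp (t * ∑ r, G.linFeat v (d r)) := by
  simp only [weight_add_smul, Finset.prod_mul_distrib, ← Real.exp_sum, Finset.mul_sum]

theorem sampleProb_eq_gibbs (m : ℕ) (Θ : G.Param) :
    G.sampleProb (m := m) Θ = gibbs fun d => ∏ t, G.weight Θ (d t) := by
  funext d
  simp only [sampleProb, gibbs, prob, Finset.prod_div_distrib, Finset.prod_const, Finset.card_univ,
    Fintype.card_fin]
  rw [Fintype.sum_pow]

theorem sum_prod_weight_ne_zero [NeZero k] (m : ℕ) (Θ : G.Param) :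
    ∑ d : Fin m → G.State, ∏ r, G.weight Θ (d r) ≠ 0 := by
  rw [← Fintype.sum_pow]
  exact (pow_pos (G.sum_weight_pos Θ) m).ne'

theorem hasDerivAt_wmean_sampleProb [NeZero k] {m : ℕ} (Θ v : G.Param)
    (f : (Fin m → G.State) → ℝ) (t : ℝ) :
    HasDerivAt (fun τ : ℝ => wmean (G.sampleProb (Θ + τ • v)) f)
      (wcov (G.sampleProb (Θ + t • v)) f fun d => ∑ r, G.linFeat v (d r)) t := by
  have h := hasDerivAt_wmean_gibbs (fun d : Fin m → G.State => ∏ r, G.weight Θ (d r)) f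
    (fun d => ∑ r, G.linFeat v (d r)) t (by
      simpa only [← prod_weight_add_smul] using G.sum_prod_weight_ne_zero m _)
  simpa only [← prod_weight_add_smul, ← sampleProb_eq_gibbs] using h

-- Both sides are the derivative of the same mean, since means in an exponential family
-- differentiate to covariances with the sufficient statistic.
theorem wvar_sampleProb_sum [NeZero k] (m : ℕ) (Θ v : G.Param) :
    wvar (G.sampleProb Θ) (fun d : Fin m → G.State => ∑ r, G.linFeat v (d r)) =
      m * wvar (G.prob Θ) (G.linFeat v) := by
  have hmean (τ : ℝ) : wmean (G.sampleProb (Θ + τ • v))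
      (fun d : Fin m → G.State => ∑ r, G.linFeat v (d r)) =
      m * wmean (G.prob (Θ + τ • v)) (G.linFeat v) := by
    simp_rw [wmean_sum, show G.sampleProb (Θ + τ • v) = fun d : Fin m → G.State =>
      ∏ t, G.prob (Θ + τ • v) (d t) from rfl, wmean_pi_eval (G.sum_prob _) (G.linFeat v)]
    simp
  have hsample := G.hasDerivAt_wmean_sampleProb Θ v
    (fun d : Fin m → G.State => ∑ r, G.linFeat v (d r)) 0
  have hsingle := (G.hasDerivAt_wmean_prob Θ v (G.linFeat v) 0).const_mul (m : ℝ)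
  simp only [hmean] at hsample
  simpa only [wvar, zero_smul, add_zero] using hsample.unique hsingle

theorem inner_estMean {m : ℕ} (T : (Fin m → G.State) → G.Param) (Θ u : G.Param) :
    inner ℝ u (G.estMean T Θ) = wmean (G.sampleProb Θ) fun d => inner ℝ u (T d) := by
  simp only [estMean, wmean, inner_sum, inner_smul_right]

variable {G}

theorem UnbiasedAt.hasDerivAt_wmean {m : ℕ} {T : (Fin m → G.State) → G.Param} {Θ : G.Param}
    (hT : G.UnbiasedAt T Θ) (u : G.Param) :
    HasDerivAt (fun τ : ℝ => wmean (G.sampleProb (Θ + τ • u)) fun d => inner ℝ u (T d))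
      (‖u‖ ^ 2) 0 := by
  have hline : HasDerivAt (fun τ : ℝ => Θ + τ • u) u 0 := by
    simpa using ((hasDerivAt_id (0 : ℝ)).smul_const u).const_add Θ
  have hmean : HasDerivAt (fun τ : ℝ => inner ℝ u (G.estMean T (Θ + τ • u))) (‖u‖ ^ 2) 0 := by
    have h := (innerSL ℝ u).hasFDerivAt.comp_hasDerivAt (0 : ℝ)
      (HasFDerivAt.comp_hasDerivAt (l := G.estMean T) (0 : ℝ) (by simpa using hT.2) hline)
    simpa [Function.comp_def, real_inner_self_eq_norm_sq] using h
  simpa only [inner_estMean] using hmean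

theorem CovLE.wvar_le [NeZero k] {m : ℕ} {T : (Fin m → G.State) → G.Param} {Θ : G.Param} {b : ℝ}
    (hT : G.CovLE T Θ b) (u : G.Param) :
    wvar (G.sampleProb Θ) (fun d => inner ℝ u (T d)) ≤ b * ‖u‖ ^ 2 := by
  rw [wvar_eq_wmean_sq (G.sum_sampleProb Θ), ← inner_estMean]
  simpa only [wmean, inner_sub_right] using hT u

theorem norm_sq_le_of_unbiasedAt_of_covLE [NeZero k] {m : ℕ} {T : (Fin m → G.State) → G.Param}
    {Θ : G.Param} {b : ℝ} (hT : G.UnbiasedAt T Θ) (hcov : G.CovLE T Θ b) (u : G.Param) :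
    ‖u‖ ^ 2 ≤ b * m * wvar (G.prob Θ) (G.linFeat u) := by
  have hcr : (‖u‖ ^ 2) ^ 2 ≤ wvar (G.sampleProb Θ) (fun d => inner ℝ u (T d)) *
      wvar (G.sampleProb Θ) (fun d : Fin m → G.State => ∑ r, G.linFeat u (d r)) := by
    have h := cramer_rao_gibbs (w := fun d : Fin m → G.State => ∏ r, G.weight Θ (d r))
      (g := fun d => ∑ r, G.linFeat u (d r)) (T := fun d => inner ℝ u (T d)) (t := 0)
      (fun d => Finset.prod_nonneg fun r _ => (G.weight_pos Θ (d r)).le)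
      (by simpa only [← prod_weight_add_smul] using G.sum_prod_weight_ne_zero m _)
      (by simpa only [← prod_weight_add_smul, ← sampleProb_eq_gibbs] using hT.hasDerivAt_wmean u)
    simpa only [← prod_weight_add_smul, ← sampleProb_eq_gibbs, zero_smul, add_zero] using h
  have hV : 0 ≤ m * wvar (G.prob Θ) (G.linFeat u) :=
    mul_nonneg m.cast_nonneg (wvar_nonneg (G.prob_nonneg Θ) _)
  rw [wvar_sampleProb_sum] at hcr
  rcases (sq_nonneg ‖u‖).eq_or_lt with hu | hu
  · have hu0 : u = 0 := by simpa using hu.symm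
    have hlin : G.linFeat 0 = fun _ => 0 := by
      funext s
      simp [linFeat]
    simp [hu0, hlin, wvar_const]
  · refine le_of_mul_le_mul_left ?_ hu
    calc ‖u‖ ^ 2 * ‖u‖ ^ 2 = (‖u‖ ^ 2) ^ 2 := (sq _).symm
      _ ≤ b * ‖u‖ ^ 2 * (m * wvar (G.prob Θ) (G.linFeat u)) :=
        hcr.trans (mul_le_mul_of_nonneg_right (hcov.wvar_le u) hV)
      _ = ‖u‖ ^ 2 * (b * m * wvar (G.prob Θ) (G.linFeat u)) := by ring

theorem EfficientEstimator.le_wvar [NeZero k] {F : Set G.Param} {c : ℝ} {m : ℕ} (hc : 0 < c)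
    (hm : 0 < m) (heff : G.EfficientEstimator F c m) {Θ : G.Param} (hΘ : Θ ∈ F) (u : G.Param) :
    2 * c * ‖u‖ ^ 2 ≤ wvar (G.prob Θ) (G.linFeat u) := by
  obtain ⟨T, hunbiased, hcov⟩ := heff Θ hΘ
  have : (0 : ℝ) < m := Nat.cast_pos.mpr hm
  calc 2 * c * ‖u‖ ^ 2
      ≤ 2 * c * (1 / (2 * c * m) * m * wvar (G.prob Θ) (G.linFeat u)) := by
        gcongr
        exact norm_sq_le_of_unbiasedAt_of_covLE hunbiased hcov u
    _ = wvar (G.prob Θ) (G.linFeat u) := by field_simp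

end WIS

namespace WIS

variable {k khat n : ℕ} (G : WIS k khat n)

/-! ### The law of the outputs and the posterior -/

theorem outProb_eq_div (Θ : G.Param) (o : G.Out) :
    G.outProb Θ o = (∑ s, G.outWeight Θ o s) / ∑ s, G.weight Θ s := by
  simp only [outProb, outWeight, prob, Finset.sum_div, ite_div, zero_div]

theorem outProb_pos [NeZero k] (Θ : G.Param) (o : G.Out) : 0 < G.outProb Θ o := by
  rw [outProb_eq_div]
  exact div_pos (G.sum_outWeight_pos Θ o) (G.sum_weight_pos Θ)

theorem outProb_nonneg [NeZero k] (Θ : G.Param) (o : G.Out) : 0 ≤ G.outProb Θ o :=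
  (G.outProb_pos Θ o).le

theorem sum_outProb [NeZero k] (Θ : G.Param) : ∑ o, G.outProb Θ o = 1 := by
  simp only [outProb]
  rw [Finset.sum_comm]
  simpa using G.sum_prob Θ

theorem outProb_mul_condProb [NeZero k] (Θ : G.Param) (o : G.Out) (s : G.State) :
    G.outProb Θ o * G.condProb Θ o s = if s.2.2 = o then G.prob Θ s else 0 := by
  have hout : ∑ s, G.outWeight Θ o s ≠ 0 := (G.sum_outWeight_pos Θ o).ne'
  rw [outProb_eq_div, condProb_eq_gibbs, gibbs, div_mul_div_cancel₀' hout, outWeight, ite_div,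
    zero_div, prob]

theorem wmean_outProb_wmean_condProb [NeZero k] (Θ : G.Param) (f : G.State → ℝ) :
    wmean (G.outProb Θ) (fun o => wmean (G.condProb Θ o) f) = wmean (G.prob Θ) f := by
  simp only [wmean, Finset.mul_sum, ← mul_assoc, outProb_mul_condProb]
  rw [Finset.sum_comm]
  simp

theorem posterior_nonneg [NeZero k] (Θ : G.Param) (o : G.Out) (y : Fin k) :
    0 ≤ G.posterior Θ o y :=
  Finset.sum_nonneg fun s _ => ite_nonneg (G.condProb_nonneg Θ o s) le_rfl

theorem wmean_posterior (Θ : G.Param) (o : G.Out) (a : Fin k → ℝ) :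
    wmean (G.posterior Θ o) a = wmean (G.condProb Θ o) fun s => a s.1 := by
  simp only [wmean, posterior, Finset.sum_mul]
  rw [Finset.sum_comm]
  simp

theorem sum_posterior [NeZero k] (Θ : G.Param) (o : G.Out) : ∑ y, G.posterior Θ o y = 1 := by
  simpa [wmean, G.sum_condProb] using G.wmean_posterior Θ o fun _ => 1

theorem outProb_mul_posterior [NeZero k] (Θ : G.Param) (o : G.Out) (y : Fin k) :
    G.outProb Θ o * G.posterior Θ o y = G.labelOutProb Θ y o := by
  simp only [posterior, labelOutProb, Finset.mul_sum, mul_ite, mul_zero, outProb_mul_condProb,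
    ite_and]

theorem sum_labelOutProb [NeZero k] (Θ : G.Param) (o : G.Out) :
    ∑ y, G.labelOutProb Θ y o = G.outProb Θ o := by
  simp only [← outProb_mul_posterior, ← Finset.mul_sum, sum_posterior, mul_one]

/-! ### Increments of the factors -/

theorem relFactor_sub_sq_le (r : LabelRel) (a b a' b' : Bool) :
    (relFactor r a b - relFactor r a' b') ^ 2 ≤
      ((if a = true then (1 : ℝ) else 0) - if a' = true then 1 else 0) ^ 2 +
        ((if b = true then (1 : ℝ) else 0) - if b' = true then 1 else 0) ^ 2 := by
  cases r <;> cases a <;> cases b <;> cases a' <;> cases b' <;> norm_num [relFactor]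

theorem relFactor_sub_mem (r : LabelRel) (a b a' b' : Bool) :
    relFactor r a b - relFactor r a' b' ∈ ({-1, 0, 1} : Set ℝ) := by
  cases r <;> cases a <;> cases b <;> cases a' <;> cases b' <;> norm_num [relFactor]

theorem factor_sub_mem (f : G.Factor) (s s' : G.State) :
    G.factor f s - G.factor f s' ∈ ({-1, 0, 1} : Set ℝ) := by
  rcases f with p | p | p | p
  · simp only [factor]
    split_ifs <;> norm_num
  · simp only [factor]
    split_ifs <;> norm_num
  · exact relFactor_sub_mem _ _ _ _ _
  · exact relFactor_sub_mem _ _ _ _ _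

theorem abs_factor_sub_eq_sq (f : G.Factor) (s s' : G.State) :
    |G.factor f s - G.factor f s'| = (G.factor f s - G.factor f s') ^ 2 := by
  rcases G.factor_sub_mem f s s' with h | h | h <;> rw [h] <;> norm_num

theorem norm_feat_sub_sq_le (s s' : G.State) :
    ‖G.feat s - G.feat s'‖ ^ 2 ≤ G.numFactors := by
  rw [EuclideanSpace.norm_sq_eq]
  calc ∑ f, ‖(G.feat s - G.feat s') f‖ ^ 2 ≤ ∑ _f : G.Factor, (1 : ℝ) := by
        refine Finset.sum_le_sum fun f _ => ?_
        change ‖G.factor f s - G.factor f s'‖ ^ 2 ≤ 1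
        rcases G.factor_sub_mem f s s' with h | h | h <;> rw [h] <;> norm_num
    _ = G.numFactors := by simp [numFactors]

/-! ### Posterior variances of the factors -/

/-- The posterior variance of the indicator of the desired label `y`. -/
def labelVar (Θ : G.Param) (o : G.Out) (y : Fin k) : ℝ :=
  wvar (G.condProb Θ o) fun s => if s.1 = y then 1 else 0

/-- The posterior variance of the indicator of the seen label `i`. -/
def seenVar (Θ : G.Param) (o : G.Out) (i : Fin khat) : ℝ :=
  wvar (G.condProb Θ o) fun s => if s.2.1 i = true then 1 else 0

/-- The posterior variance of the factor `f`. -/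
def factorVar (Θ : G.Param) (o : G.Out) (f : G.Factor) : ℝ := wvar (G.condProb Θ o) (G.factor f)

variable [NeZero k]

theorem factorVar_nonneg (Θ : G.Param) (o : G.Out) (f : G.Factor) : 0 ≤ G.factorVar Θ o f :=
  wvar_nonneg (G.condProb_nonneg Θ o) _

theorem condVar_eq_wvar (Θ : G.Param) (o : G.Out) (g : G.State → ℝ) :
    G.condVar Θ o g = wvar (G.condProb Θ o) g :=
  (wvar_eq_wmean_sq (G.sum_condProb Θ o) g).symm

theorem factorVar_pseudoAccuracy_le (Θ : G.Param) (o : G.Out)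
    (p : {p : G.Known × Fin n × Fin khat // p.2.2 ∈ G.nonExcl p.1 p.2.1}) :
    G.factorVar Θ o (.inl p) ≤
      if (o p.1.2.1).1 = p.1.2.2 then G.labelVar Θ o p.1.1.1 else 0 := by
  split_ifs with ho
  · refine wvar_mono (G.condProb_nonneg Θ o) fun s s' hs hs' => ?_
    simp [factor, G.out_eq_of_condProb_ne_zero hs, G.out_eq_of_condProb_ne_zero hs', ho]
  · refine (wvar_mono (g := fun _ => 0) (G.condProb_nonneg Θ o) fun s s' hs hs' => ?_).trans_eq
      (wvar_const _ 0)
    simp [factor, G.out_eq_of_condProb_ne_zero hs, G.out_eq_of_condProb_ne_zero hs', ho]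

theorem factorVar_accuracy_le (Θ : G.Param) (o : G.Out)
    (p : {p : Fin n × Fin khat // p.2 ∈ G.space p.1}) :
    G.factorVar Θ o (.inr (.inl p)) ≤ G.seenVar Θ o p.1.2 := by
  refine wvar_mono (G.condProb_nonneg Θ o) fun s s' hs hs' => ?_
  simp only [factor, G.out_eq_of_condProb_ne_zero hs, G.out_eq_of_condProb_ne_zero hs']
  split_ifs <;> simp_all

theorem factorVar_seenRelation_le (Θ : G.Param) (o : G.Out)
    (p : {p : Fin khat × Fin khat // p.1 < p.2}) :
    G.factorVar Θ o (.inr (.inr (.inl p))) ≤ G.seenVar Θ o p.1.1 + G.seenVar Θ o p.1.2 :=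
  wvar_le_add (G.condProb_nonneg Θ o) fun _ _ _ _ => relFactor_sub_sq_le _ _ _ _ _

theorem factorVar_labelRelation_le (Θ : G.Param) (o : G.Out) (p : G.Known × Fin khat) :
    G.factorVar Θ o (.inr (.inr (.inr p))) ≤ G.labelVar Θ o p.1.1 + G.seenVar Θ o p.2 :=
  wvar_le_add (G.condProb_nonneg Θ o) fun s s' _ _ => by
    simpa [factor] using relFactor_sub_sq_le (G.rel (Sum.inl p.1.1) (Sum.inr p.2))
      (decide (s.1 = p.1.1)) (s.2.1 p.2) (decide (s'.1 = p.1.1)) (s'.2.1 p.2)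

theorem sum_factorVar_pseudoAccuracy_sq_le (Θ : G.Param) (o : G.Out) :
    ∑ p : {p : G.Known × Fin n × Fin khat // p.2.2 ∈ G.nonExcl p.1 p.2.1},
        G.factorVar Θ o (.inl p) ^ 2 ≤
      ∑ y : G.Known, (G.numNonExcl y : ℝ) * G.labelVar Θ o y ^ 2 := by
  calc _ ≤ ∑ p : {p : G.Known × Fin n × Fin khat // p.2.2 ∈ G.nonExcl p.1 p.2.1},
        (if (o p.1.2.1).1 = p.1.2.2 then G.labelVar Θ o p.1.1 ^ 2 else 0) := by
        refine Finset.sum_le_sum fun p _ => ?_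
        refine (pow_le_pow_left₀ (G.factorVar_nonneg Θ o _)
          (G.factorVar_pseudoAccuracy_le Θ o p) 2).trans_eq ?_
        rw [ite_pow, zero_pow two_ne_zero]
    _ = ∑ y : G.Known, ∑ j, ∑ i, (if i ∈ G.nonExcl y j then
          (if (o j).1 = i then G.labelVar Θ o y ^ 2 else 0) else 0) := by
        rw [sum_subtype_eq_sum_ite
          (fun p : G.Known × Fin n × Fin khat => p.2.2 ∈ G.nonExcl p.1 p.2.1)
          fun p => if (o p.2.1).1 = p.2.2 then G.labelVar Θ o p.1 ^ 2 else 0]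
        simp only [Fintype.sum_prod_type]
    _ = ∑ y : G.Known, ∑ j, (if (o j).1 ∈ G.nonExcl y j then G.labelVar Θ o y ^ 2 else 0) := by
        simp only [← ite_and, and_comm (b := (o _).1 = _)]
        simp only [ite_and, Finset.sum_ite_eq, Finset.mem_univ, if_true]
    _ ≤ ∑ y : G.Known, ∑ j, (if (G.nonExcl y j).Nonempty then G.labelVar Θ o y ^ 2 else 0) := by
        refine Finset.sum_le_sum fun y _ => Finset.sum_le_sum fun j _ => ?_
        by_cases hj : (o j).1 ∈ G.nonExcl y j
        · rw [if_pos hj, if_pos ⟨_, hj⟩]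
        · rw [if_neg hj]
          exact ite_nonneg (sq_nonneg _) le_rfl
    _ = ∑ y : G.Known, (G.numNonExcl y : ℝ) * G.labelVar Θ o y ^ 2 := by
        simp only [← Finset.sum_filter, Finset.sum_const, nsmul_eq_mul, numNonExcl]

theorem sum_factorVar_accuracy_sq_le (Θ : G.Param) (o : G.Out) :
    ∑ p : {p : Fin n × Fin khat // p.2 ∈ G.space p.1}, G.factorVar Θ o (.inr (.inl p)) ^ 2 ≤
      ∑ i, (G.numCover i : ℝ) * G.seenVar Θ o i ^ 2 := by
  calc _ ≤ ∑ p : {p : Fin n × Fin khat // p.2 ∈ G.space p.1}, G.seenVar Θ o p.1.2 ^ 2 :=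
        Finset.sum_le_sum fun p _ =>
          pow_le_pow_left₀ (G.factorVar_nonneg Θ o _) (G.factorVar_accuracy_le Θ o p) 2
    _ = ∑ j, ∑ i, (if i ∈ G.space j then G.seenVar Θ o i ^ 2 else 0) := by
        rw [sum_subtype_eq_sum_ite (fun p : Fin n × Fin khat => p.2 ∈ G.space p.1)
          fun p => G.seenVar Θ o p.2 ^ 2, Fintype.sum_prod_type]
    _ = ∑ i, (G.numCover i : ℝ) * G.seenVar Θ o i ^ 2 := by
        rw [Finset.sum_comm]
        simp only [← Finset.sum_filter, Finset.sum_const, nsmul_eq_mul, numCover]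

theorem sum_factorVar_seenRelation_sq_le (Θ : G.Param) (o : G.Out) :
    ∑ p : {p : Fin khat × Fin khat // p.1 < p.2}, G.factorVar Θ o (.inr (.inr (.inl p))) ^ 2 ≤
      ((khat : ℝ) - 1) * ∑ i, 2 * G.seenVar Θ o i ^ 2 := by
  have hpairs := sum_lt_pairs_add fun i => 2 * G.seenVar Θ o i ^ 2
  rw [Fintype.card_fin] at hpairs
  rw [← hpairs]
  refine Finset.sum_le_sum fun p _ => ?_
  rw [← mul_add]
  exact (pow_le_pow_left₀ (G.factorVar_nonneg Θ o _)
    (G.factorVar_seenRelation_le Θ o p) 2).trans add_sq_le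

theorem sum_factorVar_labelRelation_sq_le (Θ : G.Param) (o : G.Out) :
    ∑ p : G.Known × Fin khat, G.factorVar Θ o (.inr (.inr (.inr p))) ^ 2 ≤
      khat * ∑ y : G.Known, 2 * G.labelVar Θ o y ^ 2 +
        Fintype.card G.Known * ∑ i, 2 * G.seenVar Θ o i ^ 2 := by
  calc _ ≤ ∑ p : G.Known × Fin khat,
        (2 * G.labelVar Θ o p.1 ^ 2 + 2 * G.seenVar Θ o p.2 ^ 2) := by
        refine Finset.sum_le_sum fun p _ => ?_
        rw [← mul_add]
        exact (pow_le_pow_left₀ (G.factorVar_nonneg Θ o _)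
          (G.factorVar_labelRelation_le Θ o p) 2).trans add_sq_le
    _ = _ := by
        rw [Fintype.sum_prod_type]
        simp only [Finset.sum_add_distrib, Finset.sum_const, Finset.card_univ, Fintype.card_fin,
          nsmul_eq_mul, Finset.mul_sum]

theorem posteriorSpread_eq (Θ : G.Param) (o : G.Out) :
    G.posteriorSpread Θ o =
      ∑ y : G.Known, (G.numNonExcl y : ℝ) * G.labelVar Θ o y ^ 2 +
        khat * ∑ y : G.Known, G.labelVar Θ o y ^ 2 +
        ∑ i, (G.numCover i : ℝ) * G.seenVar Θ o i ^ 2 +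
        ((khat : ℝ) + Fintype.card G.Known - 1) * ∑ i, G.seenVar Θ o i ^ 2 := by
  simp only [posteriorSpread, condVar_eq_wvar, labelVar, seenVar, add_mul, sub_mul, add_sub_assoc,
    Finset.sum_add_distrib, Finset.sum_sub_distrib, Finset.mul_sum]
  ring

theorem sum_factorVar_sq_le (Θ : G.Param) (o : G.Out) :
    ∑ f, G.factorVar Θ o f ^ 2 ≤ 2 * G.posteriorSpread Θ o := by
  have hpseudo := G.sum_factorVar_pseudoAccuracy_sq_le Θ o
  have hacc := G.sum_factorVar_accuracy_sq_le Θ o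
  have hseen := G.sum_factorVar_seenRelation_sq_le Θ o
  have hlabel := G.sum_factorVar_labelRelation_sq_le Θ o
  have hpseudo_nonneg : 0 ≤ ∑ y : G.Known, (G.numNonExcl y : ℝ) * G.labelVar Θ o y ^ 2 :=
    Finset.sum_nonneg fun _ _ => by positivity
  have hacc_nonneg : 0 ≤ ∑ i, (G.numCover i : ℝ) * G.seenVar Θ o i ^ 2 :=
    Finset.sum_nonneg fun _ _ => by positivity
  rw [Fintype.sum_sum_type, Fintype.sum_sum_type, Fintype.sum_sum_type, posteriorSpread_eq]
  simp only [← Finset.mul_sum] at hseen hlabel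
  linarith

theorem posteriorSpread_nonneg (Θ : G.Param) (o : G.Out) : 0 ≤ G.posteriorSpread Θ o := by
  linarith [(Finset.sum_nonneg fun f _ => sq_nonneg _).trans (G.sum_factorVar_sq_le Θ o)]

theorem sum_factorVar_le (Θ : G.Param) (o : G.Out) :
    ∑ f, G.factorVar Θ o f ≤ √(2 * G.numFactors) * √(G.posteriorSpread Θ o) := by
  rw [← Real.sqrt_mul (by positivity)]
  refine Real.le_sqrt_of_sq_le ?_
  calc (∑ f, G.factorVar Θ o f) ^ 2 ≤ G.numFactors * ∑ f, G.factorVar Θ o f ^ 2 :=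
        sq_sum_le_card_mul_sum_sq
    _ ≤ G.numFactors * (2 * G.posteriorSpread Θ o) := by
        gcongr
        exact G.sum_factorVar_sq_le Θ o
    _ = 2 * G.numFactors * G.posteriorSpread Θ o := by ring

theorem wvar_condProb_linFeat_le (Θ : G.Param) (o : G.Out) (u : G.Param) :
    wvar (G.condProb Θ o) (G.linFeat u) ≤
      ‖u‖ ^ 2 * √(2 * G.numFactors) * √(G.posteriorSpread Θ o) := by
  calc wvar (G.condProb Θ o) (G.linFeat u)
      ≤ (∑ f, u f ^ 2) * ∑ f, G.factorVar Θ o f :=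
        wvar_sum_le (G.condProb_nonneg Θ o) u G.factor
    _ = ‖u‖ ^ 2 * ∑ f, G.factorVar Θ o f := by rw [EuclideanSpace.real_norm_sq_eq]
    _ ≤ _ := by
        rw [mul_assoc]
        exact mul_le_mul_of_nonneg_left (G.sum_factorVar_le Θ o) (sq_nonneg _)

theorem wcov_condProb_linFeat_le (Θ : G.Param) (o : G.Out) (u : G.Param) {a : G.State → ℝ}
    (ha : ∀ s, |a s| ≤ 1) :
    wcov (G.condProb Θ o) a (G.linFeat u) ≤ 2 * √2 * ‖u‖ * √(G.posteriorSpread Θ o) := by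
  have hfactor (f : G.Factor) :
      wcov (G.condProb Θ o) a (G.factor f) ^ 2 ≤ (2 * G.factorVar Θ o f) ^ 2 := by
    have habs := abs_wcov_le_two_mul_wvar (G.condProb_nonneg Θ o) ha
      fun s s' => (G.abs_factor_sub_eq_sq f s s').le
    exact sq_le_sq' (neg_le_of_abs_le habs) (le_of_abs_le habs)
  refine le_of_sq_le_sq ?_ (by positivity)
  calc wcov (G.condProb Θ o) a (G.linFeat u) ^ 2
      = (∑ f, u f * wcov (G.condProb Θ o) a (G.factor f)) ^ 2 :=
        congrArg (· ^ 2) (wcov_sum_right _ _ _ _)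
    _ ≤ (∑ f, u f ^ 2) * ∑ f, wcov (G.condProb Θ o) a (G.factor f) ^ 2 :=
        Finset.sum_mul_sq_le_sq_mul_sq _ _ _
    _ ≤ ‖u‖ ^ 2 * (4 * (2 * G.posteriorSpread Θ o)) := by
        rw [← EuclideanSpace.real_norm_sq_eq]
        refine mul_le_mul_of_nonneg_left ((Finset.sum_le_sum fun f _ => hfactor f).trans ?_)
          (sq_nonneg _)
        simp only [mul_pow, ← Finset.mul_sum]
        linarith [G.sum_factorVar_sq_le Θ o]
    _ = (2 * √2 * ‖u‖ * √(G.posteriorSpread Θ o)) ^ 2 := by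
        rw [mul_pow, mul_pow, mul_pow, Real.sq_sqrt zero_le_two,
          Real.sq_sqrt (G.posteriorSpread_nonneg Θ o)]
        ring

end WIS

namespace WIS

variable {k khat n : ℕ} {G : WIS k khat n}

/-! ### Drift of the likelihood gradient and stability of the posterior -/

namespace LowPosteriorVariance

variable [NeZero k] {F : Set G.Param} {Θstar Θ : G.Param} {c : ℝ}

theorem wmean_wvar_linFeat_le (hvar : G.LowPosteriorVariance F Θstar c) (hc : 0 ≤ c) (hΘ : Θ ∈ F)
    (u : G.Param) :
    wmean (G.outProb Θstar) (fun o => wvar (G.condProb Θ o) (G.linFeat u)) ≤ c * ‖u‖ ^ 2 := by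
  set r := √(2 * G.numFactors)
  calc wmean (G.outProb Θstar) (fun o => wvar (G.condProb Θ o) (G.linFeat u))
      ≤ wmean (G.outProb Θstar) fun o => ‖u‖ ^ 2 * r * √(G.posteriorSpread Θ o) :=
        wmean_mono (G.outProb_nonneg _) fun o _ => G.wvar_condProb_linFeat_le Θ o u
    _ ≤ ‖u‖ ^ 2 * r * (c / r) := by
        rw [wmean_const_mul]
        exact mul_le_mul_of_nonneg_left (hvar Θ hΘ) (by positivity)
    _ = ‖u‖ ^ 2 * (r * c / r) := by ring
    _ ≤ c * ‖u‖ ^ 2 := by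
        rw [mul_comm c, mul_div_right_comm]
        gcongr
        exact mul_le_of_le_one_left hc (div_self_le_one r)

theorem wmean_wcov_linFeat_le (hvar : G.LowPosteriorVariance F Θstar c) (hΘ : Θ ∈ F)
    (u : G.Param) {a : G.Out → G.State → ℝ} (ha : ∀ o s, |a o s| ≤ 1) :
    wmean (G.outProb Θstar) (fun o => wcov (G.condProb Θ o) (a o) (G.linFeat u)) ≤
      2 * c / √G.numFactors * ‖u‖ := by
  calc wmean (G.outProb Θstar) (fun o => wcov (G.condProb Θ o) (a o) (G.linFeat u))
      ≤ wmean (G.outProb Θstar) fun o => 2 * √2 * ‖u‖ * √(G.posteriorSpread Θ o) :=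
        wmean_mono (G.outProb_nonneg _) fun o _ => G.wcov_condProb_linFeat_le Θ o u (ha o)
    _ ≤ 2 * √2 * ‖u‖ * (c / √(2 * G.numFactors)) := by
        rw [wmean_const_mul]
        exact mul_le_mul_of_nonneg_left (hvar Θ hΘ) (by positivity)
    _ = 2 * c / √G.numFactors * ‖u‖ := by
        rw [Real.sqrt_mul zero_le_two]
        field_simp

theorem wmean_posterior_sub_le (hvar : G.LowPosteriorVariance F Θstar c) (hF : Convex ℝ F)
    (hΘstar : Θstar ∈ F) (hΘ : Θ ∈ F) {a : G.Out → Fin k → ℝ} (ha : ∀ o y, |a o y| ≤ 1) :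
    wmean (G.outProb Θstar)
        (fun o => wmean (G.posterior Θ o) (a o) - wmean (G.posterior Θstar o) (a o)) ≤
      2 * c / √G.numFactors * ‖Θ - Θstar‖ := by
  simp only [wmean_sub, wmean_posterior]
  have hsegment := sub_le_of_hasDerivAt_le (φ := fun t : ℝ => wmean (G.outProb Θstar) fun o =>
      wmean (G.condProb (Θstar + t • (Θ - Θstar)) o) fun s => a o s.1)
    (fun t => HasDerivAt.fun_sum fun o _ =>
      (G.hasDerivAt_wmean_condProb Θstar (Θ - Θstar) o _ t).const_mul _)
    (fun t ht => hvar.wmean_wcov_linFeat_le (hF.add_smul_sub_mem hΘstar hΘ ht) (Θ - Θstar)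
      (a := fun o s => a o s.1) fun o s => ha o s.1)
  simpa only [one_smul, zero_smul, add_zero, add_sub_cancel] using hsegment

theorem wmean_sum_abs_posterior_sub_le (hvar : G.LowPosteriorVariance F Θstar c)
    (hF : Convex ℝ F) (hΘstar : Θstar ∈ F) (hΘ : Θ ∈ F) :
    wmean (G.outProb Θstar) (fun o => ∑ y, |G.posterior Θ o y - G.posterior Θstar o y|) ≤
      2 * c / √G.numFactors * ‖Θ - Θstar‖ := by
  refine le_of_eq_of_le ?_ <| hvar.wmean_posterior_sub_le hF hΘstar hΘ
    (a := fun o y => SignType.sign (G.posterior Θ o y - G.posterior Θstar o y)) fun o y => ?_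
  · simp only [wmean, ← Finset.sum_sub_distrib, ← sub_mul, self_mul_sign]
  · rcases lt_trichotomy (G.posterior Θ o y - G.posterior Θstar o y) 0 with h | h | h <;> simp [h]

end LowPosteriorVariance

variable (G) in
/-- The expected gradient of the marginal log-likelihood under the outputs of `π_Θstar` points from
every `Θ ∈ F` back towards `Θstar`, with strength at least `c` relative to the distance. -/
def ContractingDrift (F : Set G.Param) (Θstar : G.Param) (c : ℝ) : Prop :=
  ∀ Θ ∈ F, wmean (G.outProb Θstar) (fun o => wmean (G.condProb Θ o) (G.linFeat (Θ - Θstar))) -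
    wmean (G.prob Θ) (G.linFeat (Θ - Θstar)) ≤ -(c * ‖Θ - Θstar‖ ^ 2)

-- The Hessian of the expected log-likelihood is the mean posterior covariance of the factors minus
-- their covariance, hence at most `c - 2 * c` on `F`; the gradient vanishes at `Θstar`.
theorem EfficientEstimator.contractingDrift [NeZero k] {F : Set G.Param} {Θstar : G.Param} {c : ℝ}
    {m : ℕ} (heff : G.EfficientEstimator F c m) (hvar : G.LowPosteriorVariance F Θstar c)
    (hF : Convex ℝ F) (hc : 0 < c) (hm : 0 < m) (hΘstar : Θstar ∈ F) :
    G.ContractingDrift F Θstar c := by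
  intro Θ hΘ
  set v := Θ - Θstar with hv
  have hsegment := sub_le_of_hasDerivAt_le (K := -(c * ‖v‖ ^ 2)) (φ := fun t : ℝ =>
      wmean (G.outProb Θstar) (fun o => wmean (G.condProb (Θstar + t • v) o) (G.linFeat v)) -
        wmean (G.prob (Θstar + t • v)) (G.linFeat v))
    (fun t => (HasDerivAt.fun_sum fun o _ =>
      (G.hasDerivAt_wmean_condProb Θstar v o _ t).const_mul _).fun_sub
        (G.hasDerivAt_wmean_prob Θstar v _ t))
    (fun t ht => by
      have hmem : Θstar + t • v ∈ F := hF.add_smul_sub_mem hΘstar hΘ ht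
      have hposterior := hvar.wmean_wvar_linFeat_le hc.le hmem v
      have hmodel := heff.le_wvar hc hm hmem v
      simp only [wvar, wmean] at hposterior hmodel
      linarith)
  simpa [wmean_outProb_wmean_condProb, hv] using hsegment

end WIS

/-! ### Iteration of mean operators -/

section MeanOperator

variable {α : Type*} {F : Set α} {A : (α → ℝ) → α → ℝ}

/-- `A` acts on functions like the transition operator of a Markov chain that stays in `F`: it is
monotone with respect to comparison on `F`, and commutes with affine maps of the values. -/
structure IsMeanOperator (F : Set α) (A : (α → ℝ) → α → ℝ) : Prop where
  mono : ∀ ⦃g g'⦄, (∀ x ∈ F, g x ≤ g' x) → ∀ x, A g x ≤ A g' x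
  affine : ∀ a b g x, A (fun y => a * g y + b) x = a * A g x + b

theorem IsMeanOperator.iterate_le (hA : IsMeanOperator F A) {g : α → ℝ} {B : ℝ}
    (hg : ∀ x ∈ F, g x ≤ B) (N : ℕ) : ∀ x ∈ F, A^[N] g x ≤ B := by
  induction N with
  | zero => exact hg
  | succ N ih =>
    intro x _
    rw [Function.iterate_succ_apply']
    calc A (A^[N] g) x ≤ A (fun y => 0 * g y + B) x := hA.mono (by simpa using ih) x
      _ = B := by rw [hA.affine, zero_mul, zero_add]

theorem IsMeanOperator.iterate_le_of_contracting (hA : IsMeanOperator F A) {g : α → ℝ} {r b : ℝ}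
    (hr : 0 ≤ r) (hg : ∀ x ∈ F, A g x ≤ r * g x + b) (N : ℕ) :
    ∀ x ∈ F, A^[N] g x ≤ r ^ N * g x + b * ∑ i ∈ Finset.range N, r ^ i := by
  induction N with
  | zero => simp
  | succ N ih =>
    intro x hx
    rw [Function.iterate_succ_apply']
    calc A (A^[N] g) x
        ≤ A (fun y => r ^ N * g y + b * ∑ i ∈ Finset.range N, r ^ i) x := hA.mono ih x
      _ = r ^ N * A g x + b * ∑ i ∈ Finset.range N, r ^ i := hA.affine _ _ _ _
      _ ≤ r ^ N * (r * g x + b) + b * ∑ i ∈ Finset.range N, r ^ i := by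
          gcongr
          exact hg x hx
      _ = r ^ (N + 1) * g x + b * ∑ i ∈ Finset.range (N + 1), r ^ i := by
          rw [Finset.sum_range_succ]
          ring

end MeanOperator

theorem norm_nearest_sub_le {E : Type*} [NormedAddCommGroup E] [InnerProductSpace ℝ E]
    {F : Set E} (hF : Convex ℝ F) {x v u : E} (hv : v ∈ F) (hmin : ∀ w ∈ F, ‖x - v‖ ≤ ‖x - w‖)
    (hu : u ∈ F) : ‖v - u‖ ≤ ‖x - u‖ := by
  have : Nonempty F := ⟨⟨v, hv⟩⟩
  have hinf : ‖x - v‖ = ⨅ w : F, ‖x - w‖ := le_antisymm (le_ciInf fun w => hmin w w.2)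
    (ciInf_le ⟨0, Set.forall_mem_range.2 fun _ => norm_nonneg _⟩ (⟨v, hv⟩ : F))
  have hobtuse : inner ℝ (x - v) (u - v) ≤ 0 :=
    (norm_eq_iInf_iff_real_inner_le_zero hF hv).1 hinf u hu
  refine le_of_sq_le_sq ?_ (norm_nonneg _)
  rw [← sub_sub_sub_cancel_right x u v, norm_sub_sq_real (x - v), norm_sub_rev v u]
  linarith [sq_nonneg ‖x - v‖]

namespace WIS

variable {k khat n : ℕ} {G : WIS k khat n}

/-! ### One step of projected stochastic gradient ascent -/

theorem proj_spec {F : Set G.Param} (hFc : IsClosed F) (hne : F.Nonempty) (Θ : G.Param) :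
    G.proj F Θ ∈ F ∧ ∀ u ∈ F, ‖Θ - G.proj F Θ‖ ≤ ‖Θ - u‖ := by
  have hnearest : ∃ v ∈ F, ∀ u ∈ F, ‖Θ - v‖ ≤ ‖Θ - u‖ := by
    obtain ⟨v, hv, hmin⟩ := hFc.exists_infDist_eq_dist hne Θ
    refine ⟨v, hv, fun u hu => ?_⟩
    rw [← dist_eq_norm, ← dist_eq_norm, ← hmin]
    exact Metric.infDist_le_dist_of_mem hu
  rw [proj, dif_pos hnearest]
  exact hnearest.choose_spec

theorem norm_proj_sub_le {F : Set G.Param} (hFc : IsClosed F) (hF : Convex ℝ F) {u : G.Param}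
    (hu : u ∈ F) (Θ : G.Param) : ‖G.proj F Θ - u‖ ≤ ‖Θ - u‖ :=
  norm_nearest_sub_le hF (proj_spec hFc ⟨u, hu⟩ Θ).1 (proj_spec hFc ⟨u, hu⟩ Θ).2 hu

variable (G) in
/-- The mean of `g` after one step of stochastic gradient ascent at outputs `o`. -/
def stepMean (F : Set G.Param) (η : ℝ) (o : G.Out) (g : G.Param → ℝ) (Θ : G.Param) : ℝ :=
  wmean (G.prob Θ) fun s => wmean (G.condProb Θ o) fun s' =>
    g (G.proj F (Θ + η • (G.feat s' - G.feat s)))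

variable (G) in
/-- The mean of `g` after one step of stochastic gradient ascent at outputs sampled from the
marginal law `π_Θstar(Ŷ)`. -/
def freshStepMean (Θstar : G.Param) (F : Set G.Param) (η : ℝ) (g : G.Param → ℝ) (Θ : G.Param) :
    ℝ :=
  wmean (G.outProb Θstar) fun o => G.stepMean F η o g Θ

theorem stepMean_wmean {ι : Type*} [Fintype ι] (F : Set G.Param) (η : ℝ) (o : G.Out)
    (p : ι → ℝ) (g : ι → G.Param → ℝ) (Θ : G.Param) :
    G.stepMean F η o (fun Θ' => wmean p fun i => g i Θ') Θ =
      wmean p fun i => G.stepMean F η o (g i) Θ := by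
  simp only [stepMean, wmean_comm _ p]

section Step

variable [NeZero k] {F : Set G.Param}

theorem isMeanOperator_stepMean (hFc : IsClosed F) (hne : F.Nonempty) (η : ℝ) (o : G.Out) :
    IsMeanOperator F (G.stepMean F η o) where
  mono _ _ hg Θ := wmean_mono (G.prob_nonneg Θ) fun _ _ =>
    wmean_mono (G.condProb_nonneg Θ o) fun _ _ => hg _ (proj_spec hFc hne _).1
  affine a b g Θ := by
    simp only [stepMean, wmean_affine (G.sum_condProb Θ o), wmean_affine (G.sum_prob Θ)]

theorem isMeanOperator_freshStepMean (hFc : IsClosed F) (hne : F.Nonempty) (Θstar : G.Param)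
    (η : ℝ) : IsMeanOperator F (G.freshStepMean Θstar F η) where
  mono _ _ hg Θ := wmean_mono (G.outProb_nonneg Θstar) fun o _ =>
    (isMeanOperator_stepMean hFc hne η o).mono hg Θ
  affine a b g Θ := by
    simp only [freshStepMean, (isMeanOperator_stepMean hFc hne η _).affine,
      wmean_affine (G.sum_outProb Θstar)]

theorem stepMean_norm_sub_sq_le (hFc : IsClosed F) (hF : Convex ℝ F) {Θstar : G.Param}
    (hΘstar : Θstar ∈ F) {η : ℝ} (o : G.Out) (Θ : G.Param) :
    G.stepMean F η o (fun Θ' => ‖Θ' - Θstar‖ ^ 2) Θ ≤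
      2 * η * (wmean (G.condProb Θ o) (G.linFeat (Θ - Θstar)) -
        wmean (G.prob Θ) (G.linFeat (Θ - Θstar))) +
          (‖Θ - Θstar‖ ^ 2 + η ^ 2 * G.numFactors) := by
  set L := G.linFeat (Θ - Θstar)
  set b := ‖Θ - Θstar‖ ^ 2 + η ^ 2 * G.numFactors
  have hstep (s s' : G.State) : ‖G.proj F (Θ + η • (G.feat s' - G.feat s)) - Θstar‖ ^ 2 ≤
      2 * η * L s' + (-(2 * η) * L s + b) := by
    calc ‖G.proj F (Θ + η • (G.feat s' - G.feat s)) - Θstar‖ ^ 2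
        ≤ ‖(Θ - Θstar) + η • (G.feat s' - G.feat s)‖ ^ 2 := by
          rw [← add_sub_right_comm]
          exact pow_le_pow_left₀ (norm_nonneg _) (norm_proj_sub_le hFc hF hΘstar _) 2
      _ = ‖Θ - Θstar‖ ^ 2 + 2 * η * (L s' - L s) + η ^ 2 * ‖G.feat s' - G.feat s‖ ^ 2 := by
          rw [norm_add_sq_real, inner_smul_right, inner_sub_right, inner_feat, inner_feat,
            norm_smul, mul_pow, Real.norm_eq_abs, sq_abs]
          ring
      _ ≤ 2 * η * L s' + (-(2 * η) * L s + b) := by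
          linarith [mul_le_mul_of_nonneg_left (G.norm_feat_sub_sq_le s' s) (sq_nonneg η)]
  calc G.stepMean F η o (fun Θ' => ‖Θ' - Θstar‖ ^ 2) Θ
      ≤ wmean (G.prob Θ) fun s => wmean (G.condProb Θ o) fun s' =>
          2 * η * L s' + (-(2 * η) * L s + b) :=
        wmean_mono (G.prob_nonneg Θ) fun s _ =>
          wmean_mono (G.condProb_nonneg Θ o) fun s' _ => hstep s s'
    _ = 2 * η * (wmean (G.condProb Θ o) L - wmean (G.prob Θ) L) + b := by
        simp only [wmean_affine (G.sum_condProb Θ o), add_left_comm (2 * η * wmean _ _)]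
        rw [wmean_affine (G.sum_prob Θ)]
        ring

end Step

/-! ### Contraction of stochastic gradient ascent -/

namespace ContractingDrift

variable [NeZero k] {F : Set G.Param} {Θstar Θ : G.Param} {c : ℝ}

theorem freshStepMean_norm_sub_sq_le (hdrift : G.ContractingDrift F Θstar c) (hFc : IsClosed F)
    (hF : Convex ℝ F) (hΘstar : Θstar ∈ F) (hΘ : Θ ∈ F) {η : ℝ} (hη : 0 ≤ η) :
    G.freshStepMean Θstar F η (fun Θ' => ‖Θ' - Θstar‖ ^ 2) Θ ≤
      (1 - 2 * η * c) * ‖Θ - Θstar‖ ^ 2 + η ^ 2 * G.numFactors := by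
  set L := G.linFeat (Θ - Θstar)
  set b := ‖Θ - Θstar‖ ^ 2 + η ^ 2 * G.numFactors with hb
  calc G.freshStepMean Θstar F η (fun Θ' => ‖Θ' - Θstar‖ ^ 2) Θ
      ≤ wmean (G.outProb Θstar) fun o =>
          2 * η * (wmean (G.condProb Θ o) L - wmean (G.prob Θ) L) + b :=
        wmean_mono (G.outProb_nonneg Θstar) fun o _ => stepMean_norm_sub_sq_le hFc hF hΘstar o Θ
    _ = 2 * η * (wmean (G.outProb Θstar) (fun o => wmean (G.condProb Θ o) L) -
          wmean (G.prob Θ) L) + b := by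
        rw [wmean_affine (G.sum_outProb Θstar), wmean_sub, wmean_const (G.sum_outProb Θstar)]
    _ ≤ 2 * η * -(c * ‖Θ - Θstar‖ ^ 2) + b := by
        gcongr
        exact hdrift Θ hΘ
    _ = (1 - 2 * η * c) * ‖Θ - Θstar‖ ^ 2 + η ^ 2 * G.numFactors := by
        rw [hb]
        ring

-- The drift is at most the norm of a difference of two means of `Φ`, hence at most `√M`.
theorem norm_sub_sq_le (hdrift : G.ContractingDrift F Θstar c) (hc : 0 < c) (hΘ : Θ ∈ F) :
    ‖Θ - Θstar‖ ^ 2 ≤ G.numFactors / c ^ 2 := by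
  set v := Θ - Θstar
  have hpair (s s' : G.State) : G.linFeat v s - ‖v‖ * √G.numFactors ≤ G.linFeat v s' := by
    rw [sub_le_comm, ← inner_feat, ← inner_feat, ← inner_sub_right]
    exact (real_inner_le_norm _ _).trans <| mul_le_mul_of_nonneg_left
      (Real.le_sqrt_of_sq_le (G.norm_feat_sub_sq_le s s')) (norm_nonneg v)
  have hprob : wmean (G.prob Θ) (G.linFeat v) ≤
      wmean (G.outProb Θstar) (fun o => wmean (G.condProb Θ o) (G.linFeat v)) +
        ‖v‖ * √G.numFactors :=
    wmean_le (G.prob_nonneg Θ) (G.sum_prob Θ) fun s => sub_le_iff_le_add.1 <|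
      le_wmean (G.outProb_nonneg Θstar) (G.sum_outProb Θstar) fun o =>
        le_wmean (G.condProb_nonneg Θ o) (G.sum_condProb Θ o) fun s' => hpair s s'
  have hmain : ‖v‖ * (c * ‖v‖) ≤ ‖v‖ * √G.numFactors := by
    linarith [hdrift Θ hΘ]
  have hle : c * ‖v‖ ≤ √G.numFactors := by
    rcases (norm_nonneg v).eq_or_lt with hzero | hpos
    · simp [← hzero]
    · exact le_of_mul_le_mul_left hmain hpos
  rw [le_div_iff₀ (by positivity), mul_comm, ← mul_pow]
  exact (Real.le_sqrt (by positivity) (by positivity)).1 hle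

-- In the regime `1 < 2 * η * c` the bound holds because `F` is bounded by `norm_sub_sq_le`.
theorem iterate_freshStepMean_le (hdrift : G.ContractingDrift F Θstar c) (hc : 0 < c)
    (hFc : IsClosed F) (hF : Convex ℝ F) (hΘstar : Θstar ∈ F) (hΘ : Θ ∈ F) {η : ℝ} (hη : 0 ≤ η)
    (m : ℕ) :
    (G.freshStepMean Θstar F η)^[m] (fun Θ' => ‖Θ' - Θstar‖ ^ 2) Θ ≤
      Real.exp (-(2 * η * c * m)) * ‖Θ - Θstar‖ ^ 2 + 2 * η * G.numFactors / c := by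
  have hA := isMeanOperator_freshStepMean hFc ⟨_, hΘstar⟩ Θstar η
  rcases le_or_gt (2 * η * c) 1 with hsmall | hlarge
  · set r := 1 - 2 * η * c with hr
    have hr0 : 0 ≤ r := sub_nonneg.2 hsmall
    have hpow : r ^ m ≤ Real.exp (-(2 * η * c * m)) := by
      calc r ^ m ≤ Real.exp (-(2 * η * c)) ^ m := by
            gcongr
            linarith [Real.add_one_le_exp (-(2 * η * c))]
        _ = Real.exp (-(2 * η * c * m)) := by
            rw [← Real.exp_nat_mul]
            ring_nf
    have hgeom : 2 * η * c * ∑ i ∈ Finset.range m, r ^ i ≤ 1 := by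
      have := mul_neg_geom_sum r m
      rw [show 1 - r = 2 * η * c by rw [hr]; ring] at this
      linarith [pow_nonneg hr0 m]
    have hnoise : η ^ 2 * G.numFactors * ∑ i ∈ Finset.range m, r ^ i ≤
        2 * η * G.numFactors / c := by
      rw [le_div_iff₀ hc]
      have hηM : 0 ≤ η * G.numFactors := by positivity
      linarith [mul_le_mul_of_nonneg_left hgeom hηM]
    calc (G.freshStepMean Θstar F η)^[m] (fun Θ' => ‖Θ' - Θstar‖ ^ 2) Θ
        ≤ r ^ m * ‖Θ - Θstar‖ ^ 2 + η ^ 2 * G.numFactors * ∑ i ∈ Finset.range m, r ^ i :=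
          hA.iterate_le_of_contracting hr0
            (fun _ hΘ' => hdrift.freshStepMean_norm_sub_sq_le hFc hF hΘstar hΘ' hη) m Θ hΘ
      _ ≤ Real.exp (-(2 * η * c * m)) * ‖Θ - Θstar‖ ^ 2 + 2 * η * G.numFactors / c := by
          gcongr
  · calc (G.freshStepMean Θstar F η)^[m] (fun Θ' => ‖Θ' - Θstar‖ ^ 2) Θ
        ≤ G.numFactors / c ^ 2 := hA.iterate_le (fun _ => hdrift.norm_sub_sq_le hc) m Θ hΘ
      _ ≤ 2 * η * G.numFactors / c := by
          rw [div_le_div_iff₀ (by positivity) hc]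
          have hMc : 0 ≤ G.numFactors * c := by positivity
          linarith [mul_le_mul_of_nonneg_right hlarge.le hMc]
      _ ≤ Real.exp (-(2 * η * c * m)) * ‖Θ - Θstar‖ ^ 2 + 2 * η * G.numFactors / c :=
          le_add_of_nonneg_left (by positivity)

theorem iterate_freshStepMean_le_accuracy (hdrift : G.ContractingDrift F Θstar c) (hc : 0 < c)
    (hFc : IsClosed F) (hF : Convex ℝ F) (hΘstar : Θstar ∈ F) (hΘ : Θ ∈ F) {ε : ℝ} (hε : 0 < ε)
    {m : ℕ} (hm : Θ ≠ Θstar → 2 / (c ^ 2 * ε ^ 2) * Real.log (2 * ‖Θ - Θstar‖ ^ 2 / ε ^ 2) < m) :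
    (G.freshStepMean Θstar F (c * ε ^ 2 / 4))^[m] (fun Θ' => ‖Θ' - Θstar‖ ^ 2) Θ ≤
      G.numFactors * ε ^ 2 := by
  have hinitial : Real.exp (-(2 * (c * ε ^ 2 / 4) * c * m)) * ‖Θ - Θstar‖ ^ 2 ≤
      G.numFactors * ε ^ 2 / 2 := by
    rcases eq_or_ne Θ Θstar with rfl | hne
    · simpa using by positivity
    have hd : 0 < ‖Θ - Θstar‖ ^ 2 := by
      have := norm_pos_iff.2 (sub_ne_zero.2 hne)
      positivity
    have hM : (1 : ℝ) ≤ G.numFactors := by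
      have hpos : (0 : ℝ) < G.numFactors := by
        have := hd.trans_le (hdrift.norm_sub_sq_le hc hΘ)
        rwa [div_pos_iff_of_pos_right (by positivity)] at this
      exact_mod_cast hpos
    have hlog : Real.log (2 * ‖Θ - Θstar‖ ^ 2 / ε ^ 2) ≤ 2 * (c * ε ^ 2 / 4) * c * m := by
      have := hm hne
      rw [div_mul_eq_mul_div, div_lt_iff₀ (by positivity)] at this
      linarith
    calc Real.exp (-(2 * (c * ε ^ 2 / 4) * c * m)) * ‖Θ - Θstar‖ ^ 2
        ≤ Real.exp (-Real.log (2 * ‖Θ - Θstar‖ ^ 2 / ε ^ 2)) * ‖Θ - Θstar‖ ^ 2 := by gcongr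
      _ = ε ^ 2 / 2 := by
          rw [Real.exp_neg, Real.exp_log (by positivity), inv_div, div_mul_eq_mul_div,
            mul_div_mul_right _ _ hd.ne']
      _ ≤ G.numFactors * ε ^ 2 / 2 := by
          gcongr
          exact le_mul_of_one_le_left (sq_nonneg ε) hM
  calc _ ≤ Real.exp (-(2 * (c * ε ^ 2 / 4) * c * m)) * ‖Θ - Θstar‖ ^ 2 +
          2 * (c * ε ^ 2 / 4) * G.numFactors / c :=
        hdrift.iterate_freshStepMean_le hc hFc hF hΘstar hΘ (by positivity) m
    _ ≤ G.numFactors * ε ^ 2 / 2 + 2 * (c * ε ^ 2 / 4) * G.numFactors / c := by gcongr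
    _ = G.numFactors * ε ^ 2 := by
        field_simp
        ring

theorem iterate_freshStepMean_le_rate (hdrift : G.ContractingDrift F Θstar c) (hc : 0 < c)
    (hFc : IsClosed F) (hF : Convex ℝ F) (hΘstar : Θstar ∈ F) (hΘ : Θ ∈ F) {m : ℕ}
    (hm : 2 ≤ m) :
    (G.freshStepMean Θstar F (Real.log m / (c * m)))^[m] (fun Θ' => ‖Θ' - Θstar‖ ^ 2) Θ ≤
      4 / c ^ 2 * (G.numFactors * (Real.log m / m)) := by
  have hm2 : (2 : ℝ) ≤ m := by exact_mod_cast hm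
  have hm0 : (0 : ℝ) < m := by positivity
  have hlog : 1 / 2 ≤ Real.log m := by
    linarith [Real.log_two_gt_d9, Real.log_le_log two_pos hm2]
  have hexp : Real.exp (-(2 * (Real.log m / (c * m)) * c * m)) ≤ 2 * (Real.log m / m) := by
    calc Real.exp (-(2 * (Real.log m / (c * m)) * c * m)) = 1 / (m : ℝ) ^ 2 := by
          rw [show 2 * (Real.log m / (c * m)) * c * m = Real.log ((m : ℝ) ^ 2) by
            rw [Real.log_pow]; field_simp; norm_num, Real.exp_neg, Real.exp_log (by positivity),
            one_div]
      _ ≤ 1 / m := one_div_le_one_div_of_le hm0 (le_self_pow₀ (by linarith) two_ne_zero)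
      _ ≤ 2 * (Real.log m / m) := by
          rw [← mul_div_assoc]
          gcongr
          linarith
  calc _ ≤ Real.exp (-(2 * (Real.log m / (c * m)) * c * m)) * ‖Θ - Θstar‖ ^ 2 +
          2 * (Real.log m / (c * m)) * G.numFactors / c :=
        hdrift.iterate_freshStepMean_le hc hFc hF hΘstar hΘ (by positivity) m
    _ ≤ 2 * (Real.log m / m) * (G.numFactors / c ^ 2) +
          2 * (Real.log m / (c * m)) * G.numFactors / c := by
        gcongr
        exact hdrift.norm_sub_sq_le hc hΘ
    _ = 4 / c ^ 2 * (G.numFactors * (Real.log m / m)) := by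
        field_simp
        ring

end ContractingDrift

end WIS

/-! ### Stochastic gradient ascent over the dataset -/

theorem lintegral_ofReal_sum_smul {S α : Type*} [Fintype S] [MeasurableSpace α] {q v : S → ℝ}
    (hq : ∀ s, 0 ≤ q s) (hv : ∀ s, 0 ≤ v s) {μ : S → Measure α} {g : α → ℝ}
    (hμ : ∀ s, ∫⁻ a, ENNReal.ofReal (g a) ∂μ s = ENNReal.ofReal (v s)) :
    ∫⁻ a, ENNReal.ofReal (g a) ∂(∑ s, ENNReal.ofReal (q s) • μ s) =
      ENNReal.ofReal (wmean q v) := by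
  simp only [lintegral_finsetSum_measure, lintegral_smul_measure, hμ, smul_eq_mul, wmean,
    ← ENNReal.ofReal_mul (hq _)]
  exact (ENNReal.ofReal_sum_of_nonneg fun s _ => mul_nonneg (hq s) (hv s)).symm

theorem toMeasure_bind_of_fintype {S α : Type*} [Fintype S] [MeasurableSpace α] (p : PMF S)
    (f : S → PMF α) : (p.bind f).toMeasure = ∑ s, p s • (f s).toMeasure := by
  ext B hB
  simp [PMF.toMeasure_bind_apply _ _ _ hB, tsum_fintype, Measure.finsetSum_apply]

namespace WIS

variable {k khat n : ℕ} {G : WIS k khat n}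

variable (G) in
/-- The mean of `g` after one pass over a list of outputs. -/
def sgdMean (F : Set G.Param) (η : ℝ) (g : G.Param → ℝ) (L : List G.Out) : G.Param → ℝ :=
  L.foldr (G.stepMean F η) g

theorem wmean_sgdMean_ofFn (Θstar : G.Param) (F : Set G.Param) (η : ℝ) (g : G.Param → ℝ) (m : ℕ)
    (Θ : G.Param) :
    wmean (fun o : Fin m → G.Out => ∏ t, G.outProb Θstar (o t))
      (fun o => G.sgdMean F η g (List.ofFn o) Θ) = (G.freshStepMean Θstar F η)^[m] g Θ := by
  induction m generalizing Θ with
  | zero => simp [wmean, sgdMean]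
  | succ m ih =>
    rw [Function.iterate_succ_apply', ← funext ih]
    simp only [freshStepMean, stepMean_wmean]
    rw [wmean, ← (Fin.consEquiv fun _ => G.Out).sum_comp, Fintype.sum_prod_type]
    simp only [wmean, Finset.mul_sum, Fin.consEquiv, Equiv.coe_fn_mk, Fin.prod_univ_succ,
      Fin.cons_zero, Fin.cons_succ, List.ofFn_succ, sgdMean, List.foldr_cons, mul_assoc]

variable [NeZero k]

theorem sgdMean_nonneg (F : Set G.Param) (η : ℝ) {g : G.Param → ℝ} (hg : ∀ Θ, 0 ≤ g Θ)
    (L : List G.Out) (Θ : G.Param) : 0 ≤ G.sgdMean F η g L Θ := by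
  induction L generalizing Θ with
  | nil => exact hg Θ
  | cons o L ih =>
    exact wmean_nonneg (G.prob_nonneg Θ) fun s =>
      wmean_nonneg (G.condProb_nonneg Θ o) fun s' => ih _

theorem lintegral_sgd (F : Set G.Param) (η : ℝ) {g : G.Param → ℝ} (hg : ∀ Θ, 0 ≤ g Θ)
    (hgm : Measurable g) (L : List G.Out) (Θ : G.Param) :
    ∫⁻ θ, ENNReal.ofReal (g θ) ∂(G.sgd F η L Θ).toMeasure =
      ENNReal.ofReal (G.sgdMean F η g L Θ) := by
  induction L generalizing Θ with
  | nil =>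
    rw [sgd, PMF.toMeasure_pure, lintegral_dirac' _ hgm.ennreal_ofReal]
    rfl
  | cons o L ih =>
    have hnonneg := sgdMean_nonneg F η hg L
    simp only [sgd, sgdStep, PMF.bind_bind, PMF.pure_bind]
    rw [toMeasure_bind_of_fintype]
    refine lintegral_ofReal_sum_smul (G.prob_nonneg Θ)
      (fun s => wmean_nonneg (G.condProb_nonneg Θ o) fun s' => hnonneg _) fun s => ?_
    rw [toMeasure_bind_of_fintype]
    exact lintegral_ofReal_sum_smul (G.condProb_nonneg Θ o) (fun s' => hnonneg _) fun s' => ih _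

/-! ### The law of the learned parameter -/

variable {X W Ω : Type*} [MeasurableSpace X] [MeasurableSpace W] [MeasurableSpace Ω]
  {π : Measure (X × Fin k)} {lam : (j : Fin n) → X → {i : Fin khat // i ∈ G.space j}}

omit [NeZero k] in
theorem measurable_outputs (hlam : ∀ j i, MeasurableSet (lam j ⁻¹' {i})) :
    Measurable (G.outputs lam) :=
  measurable_pi_iff.2 fun j => measurable_to_countable' (hlam j)

variable [IsProbabilityMeasure π] {Θstar : G.Param}

theorem measureReal_outputs_eq (hlam : ∀ j i, MeasurableSet (lam j ⁻¹' {i}))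
    (hspec : G.WellSpecified π lam Θstar) (o : G.Out) :
    π.real {p | G.outputs lam p.1 = o} = G.outProb Θstar o := by
  have hmeas : Measurable fun p : X × Fin k => G.outputs lam p.1 :=
    (measurable_outputs hlam).comp measurable_fst
  have hunion : {p : X × Fin k | G.outputs lam p.1 = o} =
      ⋃ y ∈ (Finset.univ : Finset (Fin k)), {p | p.2 = y ∧ G.outputs lam p.1 = o} := by
    ext p
    simp
  rw [hunion, measureReal_biUnion_finset]
  · simp only [hspec _ o, sum_labelOutProb]
  · intro y _ y' _ hne
    exact Set.disjoint_left.2 fun p hp hp' => hne (hp.1.symm.trans hp'.1)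
  · exact fun y _ => (measurable_snd (measurableSet_singleton y)).inter
      (hmeas (measurableSet_singleton o))

variable {h : W → X → Fin k → ℝ} {F : Set G.Param} {Θ₀ : G.Param} {η : ℝ} {m : ℕ} {P : Measure Ω}
  {D : Ω → Fin m → X} {Θhat : Ω → G.Param} {what : Ω → W}

namespace IsRun

theorem map_eq (hrun : G.IsRun π lam h F Θ₀ η P D Θhat what)
    (hlam : ∀ j i, MeasurableSet (lam j ⁻¹' {i})) (hspec : G.WellSpecified π lam Θstar) :
    P.map Θhat = ∑ o : Fin m → G.Out, ENNReal.ofReal (∏ t, G.outProb Θstar (o t)) •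
      (G.sgd F η (List.ofFn o) Θ₀).toMeasure := by
  have hout := measurable_outputs hlam
  have : IsProbabilityMeasure (π.map Prod.fst) :=
    Measure.isProbabilityMeasure_map measurable_fst.aemeasurable
  have : IsProbabilityMeasure ((π.map Prod.fst).map (G.outputs lam)) :=
    Measure.isProbabilityMeasure_map hout.aemeasurable
  have hsingleton (o : G.Out) :
      (π.map Prod.fst).map (G.outputs lam) {o} = ENNReal.ofReal (G.outProb Θstar o) := by
    rw [Measure.map_apply hout (measurableSet_singleton o),
      Measure.map_apply measurable_fst (hout (measurableSet_singleton o)),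
      ← measureReal_outputs_eq hlam hspec, ofReal_measureReal]
    rfl
  have houts : Measurable fun (x : Fin m → X) t => G.outputs lam (x t) :=
    measurable_pi_iff.2 fun t => hout.comp (measurable_pi_apply t)
  ext B hB
  have hlaw := hrun.law Set.univ B MeasurableSet.univ hB
  rw [Set.preimage_univ, Set.univ_inter, Measure.restrict_univ] at hlaw
  rw [Measure.map_apply hrun.measurable_Θhat hB, hlaw, Measure.finsetSum_apply,
    ← lintegral_map (μ := Measure.pi fun _ => π.map Prod.fst)
      (f := fun o : Fin m → G.Out => (G.sgd F η (List.ofFn o) Θ₀).toMeasure B)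
      (measurable_of_countable _) houts,
    Measure.pi_map_pi (fun _ => hout.aemeasurable), lintegral_fintype]
  refine Finset.sum_congr rfl fun o _ => ?_
  rw [Measure.pi_singleton, Measure.smul_apply, smul_eq_mul, mul_comm,
    ENNReal.ofReal_prod_of_nonneg fun t _ => G.outProb_nonneg Θstar (o t)]
  simp only [hsingleton]

theorem integral_comp (hrun : G.IsRun π lam h F Θ₀ η P D Θhat what)
    (hlam : ∀ j i, MeasurableSet (lam j ⁻¹' {i})) (hspec : G.WellSpecified π lam Θstar)
    {g : G.Param → ℝ} (hg : ∀ Θ, 0 ≤ g Θ) (hgm : Measurable g) :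
    Integrable (fun ω => g (Θhat ω)) P ∧
      ∫ ω, g (Θhat ω) ∂P = (G.freshStepMean Θstar F η)^[m] g Θ₀ := by
  have hprod (o : Fin m → G.Out) : 0 ≤ ∏ t, G.outProb Θstar (o t) :=
    Finset.prod_nonneg fun t _ => G.outProb_nonneg Θstar (o t)
  have hmean (o : Fin m → G.Out) : 0 ≤ G.sgdMean F η g (List.ofFn o) Θ₀ :=
    sgdMean_nonneg F η hg (List.ofFn o) Θ₀
  have hlintegral : ∫⁻ ω, ENNReal.ofReal (g (Θhat ω)) ∂P =
      ENNReal.ofReal ((G.freshStepMean Θstar F η)^[m] g Θ₀) := by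
    rw [← lintegral_map (f := fun θ => ENNReal.ofReal (g θ)) hgm.ennreal_ofReal
      hrun.measurable_Θhat, hrun.map_eq hlam hspec, ← wmean_sgdMean_ofFn]
    exact lintegral_ofReal_sum_smul hprod hmean fun o => lintegral_sgd F η hg hgm _ Θ₀
  have hmeas : AEStronglyMeasurable (fun ω => g (Θhat ω)) P :=
    (hgm.comp hrun.measurable_Θhat).aestronglyMeasurable
  have hnonneg : 0 ≤ᵐ[P] fun ω => g (Θhat ω) := .of_forall fun ω => hg _
  refine ⟨(lintegral_ofReal_ne_top_iff_integrable hmeas hnonneg).1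
    (hlintegral ▸ ENNReal.ofReal_ne_top), ?_⟩
  rw [integral_eq_lintegral_of_nonneg_ae hnonneg hmeas, hlintegral, ENNReal.toReal_ofReal]
  exact (wmean_nonneg hprod hmean).trans_eq (wmean_sgdMean_ofFn Θstar F η g m Θ₀)

theorem ae_mem (hrun : G.IsRun π lam h F Θ₀ η P D Θhat what)
    (hlam : ∀ j i, MeasurableSet (lam j ⁻¹' {i})) (hspec : G.WellSpecified π lam Θstar)
    (hFc : IsClosed F) (hΘ₀ : Θ₀ ∈ F) : ∀ᵐ ω ∂P, Θhat ω ∈ F := by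
  set g : G.Param → ℝ := Fᶜ.indicator fun _ => 1
  have hg : ∀ Θ, 0 ≤ g Θ := Set.indicator_nonneg fun _ _ => zero_le_one
  obtain ⟨hint, hmean⟩ := hrun.integral_comp hlam hspec hg
    (measurable_const.indicator hFc.measurableSet.compl)
  have hle : ∫ ω, g (Θhat ω) ∂P ≤ 0 := hmean.trans_le <|
    (isMeanOperator_freshStepMean hFc ⟨_, hΘ₀⟩ Θstar η).iterate_le
      (fun Θ hΘ => by simp [g, hΘ]) m Θ₀ hΘ₀
  have hzero := (integral_eq_zero_iff_of_nonneg (fun ω => hg (Θhat ω)) hint).1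
    (hle.antisymm (integral_nonneg fun ω => hg _))
  filter_upwards [hzero] with ω hω
  by_contra hmem
  simp [g, hmem] at hω

end IsRun

end WIS

theorem integral_le_sqrt_integral_sq {Ω : Type*} [MeasurableSpace Ω] {P : Measure Ω}
    [IsProbabilityMeasure P] {f : Ω → ℝ} (hf : MemLp f 2 P) :
    ∫ ω, f ω ∂P ≤ √(∫ ω, f ω ^ 2 ∂P) := by
  have := variance_nonneg f P
  rw [variance_eq_sub hf, sub_nonneg] at this
  exact Real.le_sqrt_of_sq_le this

theorem abs_sub_iInf_le {W : Type*} {f : W → ℝ} {C : ℝ} (hf : ∀ w, 0 ≤ f w)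
    (hC : ∀ w, f w ≤ C) (w : W) : |f w - ⨅ w, f w| ≤ C := by
  have hle : ⨅ w, f w ≤ f w := ciInf_le ⟨0, Set.forall_mem_range.2 hf⟩ w
  rw [abs_of_nonneg (sub_nonneg.2 hle)]
  linarith [hC w, Real.iInf_nonneg hf]

theorem sub_iInf_le_add {W : Type*} {f g : W → ℝ} {L : ℝ} (hg : BddBelow (Set.range g))
    (hL : ∀ w, |g w - f w| ≤ L) (w : W) :
    f w - ⨅ w, f w ≤ (g w - ⨅ w, g w) + 2 * L := by
  have : Nonempty W := ⟨w⟩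
  have hinf : (⨅ w, g w) - L ≤ ⨅ w, f w := le_ciInf fun w' => by
    linarith [ciInf_le hg w', (abs_le.1 (hL w')).2]
  linarith [(abs_le.1 (hL w)).1]

theorem integral_eq_sum_setIntegral_fiber {α ι : Type*} [MeasurableSpace α] [Fintype ι]
    [MeasurableSpace ι] [MeasurableSingletonClass ι] {μ : Measure α} {g : α → ι}
    (hg : Measurable g) {f : α → ℝ} (hf : Integrable f μ) :
    ∫ a, f a ∂μ = ∑ i, ∫ a in {a | g a = i}, f a ∂μ := by
  have hfiber (i : ι) : MeasurableSet {a | g a = i} := hg (measurableSet_singleton i)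
  rw [← integral_iUnion_fintype hfiber
    (fun i j hij => Set.disjoint_left.2 fun a hi hj => hij (hi.symm.trans hj))
    fun i => hf.integrableOn]
  have huniv : ⋃ i, {a | g a = i} = Set.univ := Set.eq_univ_of_forall fun a => by simp
  rw [huniv, Measure.restrict_univ]

theorem measureReal_mul_setIntegral_mul_of_indepFun_cond {α β γ : Type*} [MeasurableSpace α]
    [MeasurableSpace β] [MeasurableSpace γ] {μ : Measure α} {A : Set α} {Y : α → β} {Z : α → γ}
    (hindep : IndepFun Y Z (ProbabilityTheory.cond μ A)) (hY : Measurable Y) (hZ : Measurable Z)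
    {f : β → ℝ} {g : γ → ℝ} (hf : Measurable f) (hg : Measurable g) (hA : μ.real A ≠ 0) :
    μ.real A * ∫ a in A, f (Y a) * g (Z a) ∂μ =
      (∫ a in A, f (Y a) ∂μ) * ∫ a in A, g (Z a) ∂μ := by
  have hcond (φ : α → ℝ) :
      ∫ a, φ a ∂ProbabilityTheory.cond μ A = (μ.real A)⁻¹ * ∫ a in A, φ a ∂μ := by
    rw [ProbabilityTheory.cond, integral_smul_measure, smul_eq_mul, ENNReal.toReal_inv]
    rfl
  have hmul := (hindep.comp hf hg).integral_mul_eq_mul_integral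
    (hf.comp hY).aestronglyMeasurable (hg.comp hZ).aestronglyMeasurable
  simp only [Pi.mul_apply, Function.comp_apply, hcond] at hmul
  field_simp at hmul
  linarith

namespace WIS

variable {k khat n : ℕ} {G : WIS k khat n}

/-! ### The cross entropy -/

section CrossEntropy

variable [NeZero k]

theorem crossEntropy_eq (v : Fin k → ℝ) (y : Fin k) :
    crossEntropy v y = Real.log (∑ l, Real.exp (v l)) - v y := by
  have hpos : 0 < ∑ l, Real.exp (v l) :=
    Finset.sum_pos (fun l _ => Real.exp_pos _) Finset.univ_nonempty
  rw [crossEntropy, Real.log_div (Real.exp_pos _).ne' hpos.ne', Real.log_exp, neg_sub]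

theorem continuous_crossEntropy (y : Fin k) :
    Continuous fun v : Fin k → ℝ => crossEntropy v y := by
  simp only [crossEntropy_eq]
  have hne (v : Fin k → ℝ) : ∑ l, Real.exp (v l) ≠ 0 :=
    (Finset.sum_pos (fun l _ => Real.exp_pos _) Finset.univ_nonempty).ne'
  fun_prop (disch := assumption)

theorem crossEntropy_nonneg (v : Fin k → ℝ) (y : Fin k) : 0 ≤ crossEntropy v y := by
  rw [crossEntropy_eq, sub_nonneg, ← Real.log_exp (v y)]
  exact Real.log_le_log (Real.exp_pos _) <|
    Finset.single_le_sum (f := fun l => Real.exp (v l)) (fun l _ => (Real.exp_pos _).le)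
      (Finset.mem_univ y)

theorem crossEntropy_le {v : Fin k → ℝ} {H : ℝ} (hv : ∀ y, |v y| ≤ H) (y : Fin k) :
    crossEntropy v y ≤ 2 * H + Real.log k := by
  have hk : (k : ℝ) ≠ 0 := NeZero.ne _
  have hlog : Real.log (∑ l, Real.exp (v l)) ≤ Real.log k + H := by
    calc Real.log (∑ l, Real.exp (v l)) ≤ Real.log (k * Real.exp H) := by
          refine Real.log_le_log
            (Finset.sum_pos (fun l _ => Real.exp_pos _) Finset.univ_nonempty) ?_
          simpa using Finset.sum_le_card_nsmul Finset.univ (fun l => Real.exp (v l)) (Real.exp H)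
            fun l _ => Real.exp_le_exp.2 (le_of_abs_le (hv l))
      _ = Real.log k + H := by rw [Real.log_mul hk (Real.exp_ne_zero H), Real.log_exp]
  rw [crossEntropy_eq]
  linarith [neg_le_of_abs_le (hv y)]

end CrossEntropy

/-! ### The noise-aware loss -/

theorem continuous_weight (s : G.State) : Continuous fun Θ : G.Param => G.weight Θ s := by
  unfold weight
  fun_prop

theorem continuous_posterior [NeZero k] (o : G.Out) (y : Fin k) :
    Continuous fun Θ : G.Param => G.posterior Θ o y := by
  have hweight := continuous_weight (G := G)
  have htotal : Continuous fun Θ : G.Param => ∑ s : G.State,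
      if s.2.2 = o then G.weight Θ s else 0 :=
    continuous_finsetSum _ fun s _ => continuous_if_const _ (fun _ => hweight s)
      fun _ => continuous_const
  exact continuous_finsetSum _ fun s _ => continuous_if_const _
    (fun _ => continuous_if_const _
      (fun _ => (hweight s).div htotal fun Θ => (G.sum_weight_out_pos Θ o).ne')
      fun _ => continuous_const)
    fun _ => continuous_const

variable [NeZero k] {X W Ω : Type*} {lam : (j : Fin n) → X → {i : Fin khat // i ∈ G.space j}}
  {h : W → X → Fin k → ℝ} {H : ℝ}

theorem noisyLoss_nonneg (Θ : G.Param) (w : W) (x : X) : 0 ≤ G.noisyLoss lam h Θ w x :=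
  wmean_nonneg (G.posterior_nonneg Θ _) (crossEntropy_nonneg (h w x))

theorem noisyLoss_le (hbound : ∀ w x y, |h w x y| ≤ H) (Θ : G.Param) (w : W) (x : X) :
    G.noisyLoss lam h Θ w x ≤ 2 * H + Real.log k :=
  wmean_le (G.posterior_nonneg Θ _) (G.sum_posterior Θ _) (crossEntropy_le (hbound w x))

theorem norm_noisyLoss_le (hbound : ∀ w x y, |h w x y| ≤ H) (Θ : G.Param) (w : W) (x : X) :
    ‖G.noisyLoss lam h Θ w x‖ ≤ 2 * H + Real.log k :=
  (Real.norm_of_nonneg (noisyLoss_nonneg Θ w x)).trans_le (noisyLoss_le hbound Θ w x)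

-- The log-partition part of the cross entropy does not depend on the label, so it cancels.
theorem abs_noisyLoss_sub_le (hbound : ∀ w x y, |h w x y| ≤ H) (Θ Θ' : G.Param) (w : W) (x : X) :
    |G.noisyLoss lam h Θ w x - G.noisyLoss lam h Θ' w x| ≤
      H * ∑ y, |G.posterior Θ (G.outputs lam x) y - G.posterior Θ' (G.outputs lam x) y| := by
  have hloss (Θ : G.Param) : G.noisyLoss lam h Θ w x = Real.log (∑ l, Real.exp (h w x l)) -
      ∑ y, G.posterior Θ (G.outputs lam x) y * h w x y := by
    simp only [noisyLoss, crossEntropy_eq, mul_sub, Finset.sum_sub_distrib, ← Finset.sum_mul,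
      sum_posterior, one_mul]
  rw [hloss, hloss, sub_sub_sub_cancel_left, abs_sub_comm, ← Finset.sum_sub_distrib,
    Finset.mul_sum]
  refine (Finset.abs_sum_le_sum_abs _ _).trans (Finset.sum_le_sum fun y _ => ?_)
  rw [← sub_mul, abs_mul, mul_comm]
  exact mul_le_mul_of_nonneg_right (hbound w x y) (abs_nonneg _)

variable [MeasurableSpace X] {π : Measure (X × Fin k)}

theorem noisyRisk_nonneg (Θ : G.Param) (w : W) : 0 ≤ G.noisyRisk π lam h Θ w :=
  integral_nonneg fun p => noisyLoss_nonneg Θ w p.1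

variable [IsProbabilityMeasure π]

theorem noisyRisk_le (hbound : ∀ w x y, |h w x y| ≤ H) (Θ : G.Param) (w : W) :
    G.noisyRisk π lam h Θ w ≤ 2 * H + Real.log k := by
  have := norm_integral_le_of_norm_le_const (μ := π) <|
    .of_forall fun p => norm_noisyLoss_le (G := G) (lam := lam) hbound Θ w p.1
  rw [probReal_univ, mul_one] at this
  exact (le_abs_self _).trans this

/-! ### Measurability and integrability of the loss -/

variable [MeasurableSpace W] [MeasurableSpace Ω]

theorem measurable_crossEntropy (hh : ∀ y, Measurable fun p : W × X => h p.1 p.2 y) (y : Fin k) :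
    Measurable fun p : W × X => crossEntropy (h p.1 p.2) y :=
  (continuous_crossEntropy y).measurable.comp (measurable_pi_iff.2 hh)

theorem measurable_noisyLoss (hlam : ∀ j i, MeasurableSet (lam j ⁻¹' {i}))
    (hh : ∀ y, Measurable fun p : W × X => h p.1 p.2 y) :
    Measurable fun q : (G.Param × W) × X => G.noisyLoss lam h q.1.1 q.1.2 q.2 := by
  have hposterior (y : Fin k) : Measurable fun q : G.Param × G.Out => G.posterior q.1 q.2 y :=
    measurable_from_prod_countable_left fun o => (continuous_posterior o y).measurable
  exact Finset.measurable_fun_sum _ fun y _ =>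
    ((hposterior y).comp <| (measurable_fst.comp measurable_fst).prodMk <|
      (measurable_outputs hlam).comp measurable_snd).mul <|
    (measurable_crossEntropy hh y).comp <|
      (measurable_snd.comp measurable_fst).prodMk measurable_snd

theorem integrable_noisyLoss (hlam : ∀ j i, MeasurableSet (lam j ⁻¹' {i}))
    (hh : ∀ y, Measurable fun p : W × X => h p.1 p.2 y) (hbound : ∀ w x y, |h w x y| ≤ H)
    (Θ : G.Param) (w : W) : Integrable (fun p => G.noisyLoss lam h Θ w p.1) π := by
  have hpair : Measurable fun p : X × Fin k => ((Θ, w), p.1) := by fun_prop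
  have hmeas := (measurable_noisyLoss (G := G) hlam hh).comp hpair
  exact .of_bound hmeas.aestronglyMeasurable (2 * H + Real.log k) <|
    .of_forall fun p => norm_noisyLoss_le hbound Θ w p.1

theorem measurable_noisyRisk (hlam : ∀ j i, MeasurableSet (lam j ⁻¹' {i}))
    (hh : ∀ y, Measurable fun p : W × X => h p.1 p.2 y) :
    Measurable fun q : G.Param × W => G.noisyRisk π lam h q.1 q.2 := by
  have hpair : Measurable fun r : (G.Param × W) × (X × Fin k) => (r.1, r.2.1) := by fun_prop
  have hmeas := (measurable_noisyLoss (G := G) hlam hh).comp hpair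
  exact (StronglyMeasurable.integral_prod_right (ν := π)
    (f := fun (q : G.Param × W) (p : X × Fin k) => G.noisyLoss lam h q.1 q.2 p.1)
    hmeas.stronglyMeasurable).measurable

theorem continuous_noisyRisk (hlam : ∀ j i, MeasurableSet (lam j ⁻¹' {i}))
    (hh : ∀ y, Measurable fun p : W × X => h p.1 p.2 y) (hbound : ∀ w x y, |h w x y| ≤ H) (w : W) :
    Continuous fun Θ : G.Param => G.noisyRisk π lam h Θ w :=
  continuous_of_dominated
    (fun Θ => (integrable_noisyLoss hlam hh hbound Θ w).aestronglyMeasurable)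
    (fun Θ => .of_forall fun p => norm_noisyLoss_le hbound Θ w p.1)
    (integrable_const _)
    (.of_forall fun _ => continuous_finsetSum _ fun y _ =>
      (continuous_posterior _ y).mul continuous_const)

theorem integrable_noisyRisk_sub_iInf (hlam : ∀ j i, MeasurableSet (lam j ⁻¹' {i}))
    (hh : ∀ y, Measurable fun p : W × X => h p.1 p.2 y) (hbound : ∀ w x y, |h w x y| ≤ H)
    {P : Measure Ω} [IsFiniteMeasure P] {Θhat : Ω → G.Param} {what : Ω → W}
    (hΘhat : Measurable Θhat) (hwhat : Measurable what) :
    Integrable (fun ω => G.noisyRisk π lam h (Θhat ω) (what ω) -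
      ⨅ w, G.noisyRisk π lam h (Θhat ω) w) P := by
  have hinf : Measurable fun Θ : G.Param => ⨅ w, G.noisyRisk π lam h Θ w :=
    (upperSemicontinuous_ciInf
      (fun Θ => ⟨0, Set.forall_mem_range.2 fun w => noisyRisk_nonneg Θ w⟩)
      fun w => (continuous_noisyRisk hlam hh hbound w).upperSemicontinuous).measurable
  exact .of_bound (((measurable_noisyRisk hlam hh).comp (hΘhat.prodMk hwhat)).sub
    (hinf.comp hΘhat)).aestronglyMeasurable (2 * H + Real.log k) <| .of_forall fun ω =>
      abs_sub_iInf_le (noisyRisk_nonneg (Θhat ω)) (noisyRisk_le hbound (Θhat ω)) (what ω)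

section WellSpecified

variable {Θstar : G.Param}

theorem setIntegral_ite_label_eq (hlam : ∀ j i, MeasurableSet (lam j ⁻¹' {i}))
    (hspec : G.WellSpecified π lam Θstar) (hindep : G.LabelCondIndep π lam)
    {f : X → ℝ} (hf : Measurable f) (o : G.Out) (y : Fin k) :
    ∫ p in {p | G.outputs lam p.1 = o}, (if p.2 = y then f p.1 else 0) ∂π =
      G.posterior Θstar o y * ∫ p in {p | G.outputs lam p.1 = o}, f p.1 ∂π := by
  set A := {p : X × Fin k | G.outputs lam p.1 = o}
  have hpos := G.outProb_pos Θstar o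
  have hA : π.real A = G.outProb Θstar o := measureReal_outputs_eq hlam hspec o
  have hlabel : ∫ p in A, (if p.2 = y then (1 : ℝ) else 0) ∂π = G.labelOutProb Θstar y o := by
    have hy : MeasurableSet {p : X × Fin k | p.2 = y} := measurable_snd (measurableSet_singleton y)
    calc ∫ p in A, (if p.2 = y then (1 : ℝ) else 0) ∂π
        = ∫ p in A, {p : X × Fin k | p.2 = y}.indicator 1 p ∂π := by
          simp only [Set.indicator_apply, Set.mem_ofPred_eq, Pi.one_apply]
      _ = π.real ({p | p.2 = y} ∩ A) := by
          rw [integral_indicator_one hy, measureReal_restrict_apply hy]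
      _ = G.labelOutProb Θstar y o := hspec y o
  have hmul := measureReal_mul_setIntegral_mul_of_indepFun_cond (hindep o) measurable_snd
    measurable_fst (f := fun z => if z = y then 1 else 0) (measurable_of_countable _) hf
    (hA ▸ hpos.ne')
  rw [hA, hlabel, ← outProb_mul_posterior, mul_assoc] at hmul
  simpa using mul_left_cancel₀ hpos.ne' hmul

theorem risk_eq_noisyRisk (hlam : ∀ j i, MeasurableSet (lam j ⁻¹' {i}))
    (hh : ∀ y, Measurable fun p : W × X => h p.1 p.2 y) (hbound : ∀ w x y, |h w x y| ≤ H)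
    (hspec : G.WellSpecified π lam Θstar) (hindep : G.LabelCondIndep π lam) (w : W) :
    risk π h w = G.noisyRisk π lam h Θstar w := by
  have hmeas (y : Fin k) : Measurable fun x => crossEntropy (h w x) y :=
    (measurable_crossEntropy hh y).comp measurable_prodMk_left
  have hint (y : Fin k) : Integrable (fun p : X × Fin k => crossEntropy (h w p.1) y) π :=
    .of_bound ((hmeas y).comp measurable_fst).aestronglyMeasurable (2 * H + Real.log k) <|
      .of_forall fun p => (Real.norm_of_nonneg (crossEntropy_nonneg _ y)).trans_le
        (crossEntropy_le (hbound w p.1) y)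
  have hlabel (y : Fin k) :
      Integrable (fun p : X × Fin k => if p.2 = y then crossEntropy (h w p.1) y else 0) π := by
    have hy : MeasurableSet {p : X × Fin k | p.2 = y} := measurable_snd (measurableSet_singleton y)
    exact ((hint y).indicator hy).congr <| .of_forall fun p => by
      simp only [Set.indicator_apply, Set.mem_ofPred_eq]
  have hsplit (p : X × Fin k) : crossEntropy (h w p.1) p.2 =
      ∑ y, if p.2 = y then crossEntropy (h w p.1) y else 0 := by simp
  have houts : Measurable fun p : X × Fin k => G.outputs lam p.1 :=
    (measurable_outputs hlam).comp measurable_fst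
  simp only [risk, noisyRisk, hsplit]
  rw [integral_eq_sum_setIntegral_fiber houts (integrable_finsetSum _ fun y _ => hlabel y),
    integral_eq_sum_setIntegral_fiber houts (integrable_noisyLoss hlam hh hbound Θstar w)]
  refine Finset.sum_congr rfl fun o _ => ?_
  calc ∫ p in {p | G.outputs lam p.1 = o},
        ∑ y, (if p.2 = y then crossEntropy (h w p.1) y else 0) ∂π
      = ∑ y, G.posterior Θstar o y *
          ∫ p in {p | G.outputs lam p.1 = o}, crossEntropy (h w p.1) y ∂π := by
        rw [integral_finsetSum _ fun y _ => (hlabel y).integrableOn]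
        simp only [setIntegral_ite_label_eq hlam hspec hindep (hmeas _)]
    _ = ∫ p in {p | G.outputs lam p.1 = o},
          ∑ y, G.posterior Θstar o y * crossEntropy (h w p.1) y ∂π := by
        rw [integral_finsetSum _ fun y _ => ((hint y).const_mul _).integrableOn]
        simp only [integral_const_mul]
    _ = ∫ p in {p | G.outputs lam p.1 = o}, G.noisyLoss lam h Θstar w p.1 ∂π :=
        setIntegral_congr_fun (houts (measurableSet_singleton o)) fun p hp => by
          have hp : G.outputs lam p.1 = o := hp
          simp only [noisyLoss, hp]

theorem integral_outputs_eq (hlam : ∀ j i, MeasurableSet (lam j ⁻¹' {i}))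
    (hspec : G.WellSpecified π lam Θstar) (φ : G.Out → ℝ) :
    ∫ p, φ (G.outputs lam p.1) ∂π = wmean (G.outProb Θstar) φ := by
  have houts : Measurable fun p : X × Fin k => G.outputs lam p.1 :=
    (measurable_outputs hlam).comp measurable_fst
  have : IsProbabilityMeasure (π.map fun p => G.outputs lam p.1) :=
    Measure.isProbabilityMeasure_map houts.aemeasurable
  rw [← integral_map houts.aemeasurable
    (measurable_of_countable φ).aestronglyMeasurable, integral_fintype .of_finite]
  refine Finset.sum_congr rfl fun o _ => ?_
  rw [map_measureReal_apply houts (measurableSet_singleton o), smul_eq_mul,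
    ← measureReal_outputs_eq hlam hspec]
  rfl

theorem abs_noisyRisk_sub_risk_le (hlam : ∀ j i, MeasurableSet (lam j ⁻¹' {i}))
    (hh : ∀ y, Measurable fun p : W × X => h p.1 p.2 y) (hbound : ∀ w x y, |h w x y| ≤ H)
    (hspec : G.WellSpecified π lam Θstar) (hindep : G.LabelCondIndep π lam) (Θ : G.Param) (w : W) :
    |G.noisyRisk π lam h Θ w - risk π h w| ≤ H * wmean (G.outProb Θstar) fun o =>
      ∑ y, |G.posterior Θ o y - G.posterior Θstar o y| := by
  have hint (Θ : G.Param) := integrable_noisyLoss (π := π) hlam hh hbound Θ w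
  set φ : G.Out → ℝ := fun o => ∑ y, |G.posterior Θ o y - G.posterior Θstar o y|
  have hφ : Integrable (fun p => φ (G.outputs lam p.1)) π :=
    (Integrable.of_finite (f := φ)).comp_measurable
      (f := fun p : X × Fin k => G.outputs lam p.1)
      ((measurable_outputs hlam).comp measurable_fst)
  calc |G.noisyRisk π lam h Θ w - risk π h w|
      = |∫ p, (G.noisyLoss lam h Θ w p.1 - G.noisyLoss lam h Θstar w p.1) ∂π| := by
        rw [risk_eq_noisyRisk hlam hh hbound hspec hindep, integral_sub (hint Θ) (hint Θstar)]
        rfl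
    _ ≤ ∫ p, |G.noisyLoss lam h Θ w p.1 - G.noisyLoss lam h Θstar w p.1| ∂π :=
        abs_integral_le_integral_abs
    _ ≤ ∫ p, H * φ (G.outputs lam p.1) ∂π :=
        integral_mono ((hint Θ).sub (hint Θstar)).abs (hφ.const_mul H) fun p =>
          abs_noisyLoss_sub_le hbound Θ Θstar w p.1
    _ = H * wmean (G.outProb Θstar) φ := by
        rw [integral_const_mul, integral_outputs_eq hlam hspec]

end WellSpecified

/-! ### Generalization of the learned end model -/

namespace IsRun

variable {F : Set G.Param} {Θstar Θ₀ : G.Param} {η : ℝ} {m : ℕ} {P : Measure Ω}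
  {D : Ω → Fin m → X} {Θhat : Ω → G.Param} {what : Ω → W}

theorem memLp_two_norm_sub (hrun : G.IsRun π lam h F Θ₀ η P D Θhat what)
    (hlam : ∀ j i, MeasurableSet (lam j ⁻¹' {i})) (hspec : G.WellSpecified π lam Θstar) :
    MemLp (fun ω => ‖Θhat ω - Θstar‖) 2 P :=
  (memLp_two_iff_integrable_sq (hrun.measurable_Θhat.sub_const
    Θstar).norm.aestronglyMeasurable).2 (hrun.integral_comp hlam hspec
      (g := fun Θ => ‖Θ - Θstar‖ ^ 2) (fun Θ => sq_nonneg _) (by fun_prop)).1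

theorem ae_risk_sub_iInf_le (hrun : G.IsRun π lam h F Θ₀ η P D Θhat what)
    (hlam : ∀ j i, MeasurableSet (lam j ⁻¹' {i}))
    (hh : ∀ y, Measurable fun p : W × X => h p.1 p.2 y)
    (hbound : ∀ w x y, |h w x y| ≤ H) (hH : 0 ≤ H) (hFc : IsClosed F)
    (hF : Convex ℝ F) (hΘstar : Θstar ∈ F) (hΘ₀ : Θ₀ ∈ F) {c : ℝ}
    (hspec : G.WellSpecified π lam Θstar) (hindep : G.LabelCondIndep π lam)
    (hvar : G.LowPosteriorVariance F Θstar c) :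
    ∀ᵐ ω ∂P, risk π h (what ω) - ⨅ w, risk π h w ≤
      (G.noisyRisk π lam h (Θhat ω) (what ω) - ⨅ w, G.noisyRisk π lam h (Θhat ω) w) +
        4 * c * H / √G.numFactors * ‖Θhat ω - Θstar‖ := by
  filter_upwards [hrun.ae_mem hlam hspec hFc hΘ₀] with ω hω
  refine (sub_iInf_le_add ⟨0, Set.forall_mem_range.2 fun w => noisyRisk_nonneg (Θhat ω) w⟩
    (fun w => (abs_noisyRisk_sub_risk_le hlam hh hbound hspec hindep (Θhat ω) w).trans <|
      mul_le_mul_of_nonneg_left (hvar.wmean_sum_abs_posterior_sub_le hF hΘstar hω) hH)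
    (what ω)).trans_eq ?_
  ring

variable [IsProbabilityMeasure P]

theorem integrable_risk_sub_iInf (hrun : G.IsRun π lam h F Θ₀ η P D Θhat what)
    (hlam : ∀ j i, MeasurableSet (lam j ⁻¹' {i}))
    (hh : ∀ y, Measurable fun p : W × X => h p.1 p.2 y) (hbound : ∀ w x y, |h w x y| ≤ H)
    (hspec : G.WellSpecified π lam Θstar) (hindep : G.LabelCondIndep π lam) :
    Integrable (fun ω => risk π h (what ω) - ⨅ w, risk π h w) P := by
  simpa only [risk_eq_noisyRisk hlam hh hbound hspec hindep] using
    integrable_noisyRisk_sub_iInf (Θhat := fun _ => Θstar) hlam hh hbound measurable_const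
      hrun.measurable_what

theorem integral_risk_sub_le (hrun : G.IsRun π lam h F Θ₀ η P D Θhat what)
    (hlam : ∀ j i, MeasurableSet (lam j ⁻¹' {i}))
    (hh : ∀ y, Measurable fun p : W × X => h p.1 p.2 y)
    (hbound : ∀ w x y, |h w x y| ≤ H) (hH : 0 ≤ H) (hFc : IsClosed F)
    (hF : Convex ℝ F) (hΘstar : Θstar ∈ F) (hΘ₀ : Θ₀ ∈ F) {c χ : ℝ}
    (hc : 0 < c) (hspec : G.WellSpecified π lam Θstar) (hindep : G.LabelCondIndep π lam)
    (hvar : G.LowPosteriorVariance F Θstar c)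
    (hgen : ∫ ω, (G.noisyRisk π lam h (Θhat ω) (what ω)
      - ⨅ w, G.noisyRisk π lam h (Θhat ω) w) ∂P ≤ χ) {ε : ℝ} (hε : 0 ≤ ε)
    (hdist : ∫ ω, ‖Θhat ω - Θstar‖ ^ 2 ∂P ≤ G.numFactors * ε ^ 2) :
    ∫ ω, (risk π h (what ω) - ⨅ w, risk π h w) ∂P ≤ χ + 4 * c * H * ε := by
  have hnoisy := integrable_noisyRisk_sub_iInf (π := π) (P := P) hlam hh hbound
    hrun.measurable_Θhat hrun.measurable_what
  have hL2 := hrun.memLp_two_norm_sub hlam hspec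
  have hnorm : Integrable (fun ω => ‖Θhat ω - Θstar‖) P := hL2.integrable one_le_two
  have hmean : ∫ ω, ‖Θhat ω - Θstar‖ ∂P ≤ √G.numFactors * ε := by
    refine (integral_le_sqrt_integral_sq hL2).trans ((Real.sqrt_le_sqrt hdist).trans_eq ?_)
    rw [Real.sqrt_mul (Nat.cast_nonneg _), Real.sqrt_sq hε]
  calc ∫ ω, (risk π h (what ω) - ⨅ w, risk π h w) ∂P
      ≤ ∫ ω, ((G.noisyRisk π lam h (Θhat ω) (what ω) - ⨅ w, G.noisyRisk π lam h (Θhat ω) w) +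
          4 * c * H / √G.numFactors * ‖Θhat ω - Θstar‖) ∂P :=
        integral_mono_ae (hrun.integrable_risk_sub_iInf hlam hh hbound hspec hindep)
          (hnoisy.add (hnorm.const_mul _))
          (hrun.ae_risk_sub_iInf_le hlam hh hbound hH hFc hF hΘstar hΘ₀ hspec hindep hvar)
    _ = ∫ ω, (G.noisyRisk π lam h (Θhat ω) (what ω) - ⨅ w, G.noisyRisk π lam h (Θhat ω) w) ∂P +
          4 * c * H / √G.numFactors * ∫ ω, ‖Θhat ω - Θstar‖ ∂P := by
        rw [integral_add hnoisy (hnorm.const_mul _), integral_const_mul]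
    _ ≤ χ + 4 * c * H / √G.numFactors * (√G.numFactors * ε) := by gcongr
    _ = χ + 4 * c * H * ε * (√G.numFactors / √G.numFactors) := by ring
    _ ≤ χ + 4 * c * H * ε := by
        gcongr χ + ?_
        exact mul_le_of_le_one_right (by positivity) (div_self_le_one _)

end IsRun

end WIS

end

theorem theorem1 {k khat n : ℕ} [NeZero k] (G : WIS k khat n)
    {X W Ω : Type*} [MeasurableSpace X] [MeasurableSpace W] [MeasurableSpace Ω]
    -- problem distribution, labeling functions, logits of the end model
    (π : Measure (X × Fin k)) [IsProbabilityMeasure π]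
    (lam : (j : Fin n) → X → {i : Fin khat // i ∈ G.space j})
    (hlam : ∀ j i, MeasurableSet (lam j ⁻¹' {i}))
    (h : W → X → Fin k → ℝ) (hh : ∀ y, Measurable fun p : W × X => h p.1 p.2 y)
    -- feasible set, true and initial parameters
    (F : Set G.Param) (hFclosed : IsClosed F) (hFconvex : Convex ℝ F)
    (Θstar Θ₀ : G.Param) (hΘstar : Θstar ∈ F) (hΘ₀ : Θ₀ ∈ F)
    (c H χ : ℝ) (hc : 0 < c) (m : ℕ) (hm : 0 < m)
    -- assumptions on the model and on the end model
    (hspec : G.WellSpecified π lam Θstar)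
    (hindep : G.LabelCondIndep π lam)
    (heff : G.EfficientEstimator F c m)
    (hvar : G.LowPosteriorVariance F Θstar c)
    (hbound : ∀ w x y, |h w x y| ≤ H)
    -- a run of the algorithm with step size `η` on a dataset of size `m`
    (P : Measure Ω) [IsProbabilityMeasure P] (η : ℝ)
    (D : Ω → Fin m → X) (Θhat : Ω → G.Param) (what : Ω → W)
    (hrun : G.IsRun π lam h F Θ₀ η P D Θhat what)
    (hgen : ∫ ω, (G.noisyRisk π lam h (Θhat ω) (what ω)
      - ⨅ w, G.noisyRisk π lam h (Θhat ω) w) ∂P ≤ χ) :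
    Integrable (fun ω => ‖Θhat ω - Θstar‖ ^ 2) P ∧
    Integrable (fun ω => WIS.risk π h (what ω) - ⨅ w, WIS.risk π h w) P ∧
    -- accuracy `ε` from a large enough dataset
    (∀ ε : ℝ, 0 < ε → η = c * ε ^ 2 / 4 →
      (m : ℝ) > 2 / (c ^ 2 * ε ^ 2) * Real.log (2 * ‖Θ₀ - Θstar‖ ^ 2 / ε ^ 2) →
      ∫ ω, ‖Θhat ω - Θstar‖ ^ 2 ∂P ≤ G.numFactors * ε ^ 2 ∧
      ∫ ω, (WIS.risk π h (what ω) - ⨅ w, WIS.risk π h w) ∂P ≤ χ + 4 * c * H * ε) ∧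
    -- the rates in terms of the size of the dataset
    (2 ≤ m → η = Real.log m / (c * m) →
      ∫ ω, ‖Θhat ω - Θstar‖ ^ 2 ∂P ≤ 4 / c ^ 2 * (G.numFactors * (Real.log m / m)) ∧
      ∫ ω, (WIS.risk π h (what ω) - ⨅ w, WIS.risk π h w) ∂P ≤
        χ + 8 * (H * Real.sqrt (Real.log m / m))) := by
  have hH : 0 ≤ H := by
    obtain ⟨ω⟩ := nonempty_of_isProbabilityMeasure P
    obtain ⟨p⟩ := nonempty_of_isProbabilityMeasure π
    exact (abs_nonneg _).trans (hbound (what ω) p.1 0)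
  have hdrift := heff.contractingDrift hvar hFconvex hc hm hΘstar
  obtain ⟨hint, hmean⟩ := hrun.integral_comp hlam hspec (g := fun Θ => ‖Θ - Θstar‖ ^ 2)
    (fun Θ => by positivity) (by fun_prop)
  have hrisk {ε : ℝ} (hε : 0 ≤ ε) (hd : ∫ ω, ‖Θhat ω - Θstar‖ ^ 2 ∂P ≤ G.numFactors * ε ^ 2) :=
    hrun.integral_risk_sub_le hlam hh hbound hH hFclosed hFconvex hΘstar hΘ₀ hc hspec hindep hvar
      hgen hε hd
  refine ⟨hint, hrun.integrable_risk_sub_iInf hlam hh hbound hspec hindep,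
    fun ε hε hη hlarge => ?_, fun hm2 hη => ?_⟩
  · subst hη
    have hd := hmean.trans_le <|
      hdrift.iterate_freshStepMean_le_accuracy hc hFclosed hFconvex hΘstar hΘ₀ hε fun _ => hlarge
    exact ⟨hd, hrisk hε.le hd⟩
  · subst hη
    have hd := hmean.trans_le <|
      hdrift.iterate_freshStepMean_le_rate hc hFclosed hFconvex hΘstar hΘ₀ hm2
    have hrate : 0 ≤ Real.log m / m := by positivity
    refine ⟨hd, (hrisk (ε := 2 / c * √(Real.log m / m)) (by positivity)
      (hd.trans_eq ?_)).trans_eq ?_⟩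
    · rw [mul_pow, Real.sq_sqrt hrate]
      ring
    · field_simp
      ring
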